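/- For $c\in\mathbb{R}$ consider, in coordinates $(\rho,\tilde\phi,\tilde\zeta_0,\zeta^0)$ of $\mathbb{R}^4$, the one-loop deformed universal hypermultiplet metric \[g_{UH}^c=\frac{1}{4\rho^2}\left(\frac{\rho+2c}{\rho+c}\,d\rho^2+\frac{\rho+c}{\rho+2c}\,(d\tilde\phi+\zeta^0d\tilde\zeta_0-\tilde\zeta_0d\zeta^0)^2+2(\rho+2c)\left((d\tilde\zeta_0)^2+(d\zeta^0)^2\right)\right).\] (i) If $c>0$, then $g^c_{UH}$ is a (positive definite) quaternionic Kähler metric of negative scalar curvature on each of the domains $\{\rho>0\}$ and $\{-c<\rho<0\}$; it is complete on $\{\rho>0\}$ and incomplete on $\{-c<\rho<0\}$. (ii) If $c<0$, then $g^c_{UH}$ is a (positive definite) quaternionic Kähler metric of negative scalar curvature on $\{\rho>-2c\}$, and it is incomplete there. (iii) If $c<0$, then $-g^c_{UH}$ is a (positive definite) quaternionic Kähler metric of positive scalar curvature on $\{-c<\rho<-2c\}$, and it is incomplete there. Here a Riemannian metric $g$ on a 4-manifold is called quaternionic Kähler if there is a rank three bundle $Q$ of $g$-skew-symmetric endomorphisms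 of the tangent bundle, locally spanned by almost complex structures $J_1,J_2,J_3=J_1J_2=-J_2J_1$, which is parallel for the Levi-Civita connection and annihilates the curvature tensor: $[A,R(X,Y)]=R(AX,Y)+R(X,AY)$ for all $A\in Q$ and all tangent vectors $X,Y$. Completeness refers to the Riemannian distance. -/

import Mathlib

open Set Filter Topology MeasureTheory
open scoped ENNReal ContDiff Matrix

noncomputable section

/-! Riemannian geometry of metrics on open subsets of the coordinate space `Fin n → ℝ`.
A (pseudo-)Riemannian metric is given by the matrix of its components
`g x i j = g_x(∂_i, ∂_j)`; endomorphisms of the tangent space are matrices acting on column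
vectors of components. -/

namespace CoordGeom

variable {n : ℕ}

/-- The partial derivative `∂_i f` at `x`. -/
def pderiv (i : Fin n) (f : (Fin n → ℝ) → ℝ) (x : Fin n → ℝ) : ℝ :=
  fderiv ℝ f x (Pi.single i 1)

/-- The entrywise partial derivative `∂_i A` at `x` of a matrix-valued function. -/
def matPderiv (i : Fin n) (A : (Fin n → ℝ) → Matrix (Fin n) (Fin n) ℝ) (x : Fin n → ℝ) :
    Matrix (Fin n) (Fin n) ℝ :=
  Matrix.of fun k j => pderiv i (fun y => A y k j) x

/-- `g` is a smooth Riemannian (that is, positive definite) metric on the open set `U`. -/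
structure IsRiemannianOn (g : (Fin n → ℝ) → Matrix (Fin n) (Fin n) ℝ)
    (U : Set (Fin n → ℝ)) : Prop where
  isOpen : IsOpen U
  smooth : ∀ i j, ContDiffOn ℝ ∞ (fun x => g x i j) U
  posDef : ∀ x ∈ U, (g x).PosDef

/-- The Christoffel symbols of the Levi-Civita connection: the matrix `Γ_i` with entries
`(Γ_i)_{kj} = Γ^k_{ij} = ½ ∑_l g^{kl} (∂_i g_{jl} + ∂_j g_{il} - ∂_l g_{ij})`, so that
`∇_{∂_i} ∂_j = ∑_k Γ^k_{ij} ∂_k`. -/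
def christoffel (g : (Fin n → ℝ) → Matrix (Fin n) (Fin n) ℝ) (i : Fin n) (x : Fin n → ℝ) :
    Matrix (Fin n) (Fin n) ℝ :=
  Matrix.of fun k j => (1 / 2 : ℝ) * ∑ l, (g x)⁻¹ k l *
    (pderiv i (fun y => g y j l) x + pderiv j (fun y => g y i l) x
      - pderiv l (fun y => g y i j) x)

/-- The curvature endomorphism
`R(∂_i, ∂_j) = ∇_{∂_i} ∇_{∂_j} - ∇_{∂_j} ∇_{∂_i} = ∂_i Γ_j - ∂_j Γ_i + [Γ_i, Γ_j]`. -/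
def curvature (g : (Fin n → ℝ) → Matrix (Fin n) (Fin n) ℝ) (i j : Fin n) (x : Fin n → ℝ) :
    Matrix (Fin n) (Fin n) ℝ :=
  matPderiv i (christoffel g j) x - matPderiv j (christoffel g i) x
    + (christoffel g i x * christoffel g j x - christoffel g j x * christoffel g i x)

/-- The Ricci tensor `Ric(∂_j, ∂_k) = tr (X ↦ R(X, ∂_j) ∂_k)`. -/
def ricci (g : (Fin n → ℝ) → Matrix (Fin n) (Fin n) ℝ) (x : Fin n → ℝ) :
    Matrix (Fin n) (Fin n) ℝ :=
  Matrix.of fun j k => ∑ i, curvature g i j x i k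

/-- The scalar curvature `∑_{j,k} g^{jk} Ric_{jk}`. -/
def scalarCurvature (g : (Fin n → ℝ) → Matrix (Fin n) (Fin n) ℝ) (x : Fin n → ℝ) : ℝ :=
  ∑ j, ∑ k, (g x)⁻¹ j k * ricci g x j k

/-- The Levi-Civita covariant derivative `∇_{∂_i} A = ∂_i A + [Γ_i, A]` of a field of
endomorphisms. -/
def covDerivEnd (g : (Fin n → ℝ) → Matrix (Fin n) (Fin n) ℝ) (i : Fin n)
    (A : (Fin n → ℝ) → Matrix (Fin n) (Fin n) ℝ) (x : Fin n → ℝ) :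
    Matrix (Fin n) (Fin n) ℝ :=
  matPderiv i A x + (christoffel g i x * A x - A x * christoffel g i x)

/-- `(J 0, J 1, J 2)` is a smooth frame over `V` of `g`-skew-symmetric almost complex structures
obeying the quaternionic relations `J_1² = J_2² = -1`, `J_1 J_2 = -J_2 J_1 = J_3`. -/
structure IsQuaternionicFrame (g : (Fin n → ℝ) → Matrix (Fin n) (Fin n) ℝ)
    (V : Set (Fin n → ℝ)) (J : Fin 3 → (Fin n → ℝ) → Matrix (Fin n) (Fin n) ℝ) : Prop where
  smooth : ∀ a i j, ContDiffOn ℝ ∞ (fun x => J a x i j) V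
  sq_zero : ∀ x ∈ V, J 0 x * J 0 x = -1
  sq_one : ∀ x ∈ V, J 1 x * J 1 x = -1
  mul_eq : ∀ x ∈ V, J 0 x * J 1 x = J 2 x
  anticomm : ∀ x ∈ V, J 1 x * J 0 x = -J 2 x
  skew : ∀ a, ∀ x ∈ V, (J a x)ᵀ * g x + g x * J a x = 0

/-- `Q` is a quaternionic structure for `(U, g)`: a rank three bundle of `g`-skew-symmetric
endomorphisms, locally spanned by smooth frames `(J_1, J_2, J_3)` with the quaternionic relations,
which is parallel for the Levi-Civita connection and annihilates the curvature tensor: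
`[A, R(X, Y)] = R(A X, Y) + R(X, A Y)` for `A ∈ Q`. (The last condition follows from the others in
dimension at least eight, and is part of the usual definition in dimension four.) -/
structure IsQuaternionicStructureOn (g : (Fin n → ℝ) → Matrix (Fin n) (Fin n) ℝ)
    (U : Set (Fin n → ℝ)) (Q : (Fin n → ℝ) → Submodule ℝ (Matrix (Fin n) (Fin n) ℝ)) :
    Prop where
  exists_parallel_frame : ∀ p ∈ U, ∃ V ⊆ U, IsOpen V ∧ p ∈ V ∧
    ∃ J : Fin 3 → (Fin n → ℝ) → Matrix (Fin n) (Fin n) ℝ,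
      IsQuaternionicFrame g V J ∧
      (∀ x ∈ V, Q x = Submodule.span ℝ (Set.range fun a => J a x)) ∧
      ∀ a i, ∀ x ∈ V, covDerivEnd g i (J a) x ∈ Q x
  annihilates_curvature : ∀ x ∈ U, ∀ A ∈ Q x, ∀ i j,
    A * curvature g i j x - curvature g i j x * A =
      ∑ m, (A m i • curvature g m j x + A m j • curvature g i m x)

/-- `g` is a (positive definite) quaternionic Kähler metric on the open set `U`. -/
def IsQuaternionicKahlerOn (g : (Fin n → ℝ) → Matrix (Fin n) (Fin n) ℝ)
    (U : Set (Fin n → ℝ)) : Prop :=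
  IsRiemannianOn g U ∧ ∃ Q, IsQuaternionicStructureOn g U Q

/-- The length `∫₀¹ √(g(γ', γ')) dt` of a curve parametrized by `[0, 1]`. -/
def curveLength (g : (Fin n → ℝ) → Matrix (Fin n) (Fin n) ℝ) (γ : ℝ → Fin n → ℝ) : ℝ≥0∞ :=
  ∫⁻ t in Icc (0 : ℝ) 1, ENNReal.ofReal
    (Real.sqrt (derivWithin γ (Icc 0 1) t ⬝ᵥ (g (γ t) *ᵥ derivWithin γ (Icc 0 1) t)))

/-- The Riemannian distance of `(U, g)`: the infimum of the lengths of the `C¹` curves in `U` from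
`x` to `y` (it is `∞` if there are none). -/
def riemDist (g : (Fin n → ℝ) → Matrix (Fin n) (Fin n) ℝ) (U : Set (Fin n → ℝ))
    (x y : Fin n → ℝ) : ℝ≥0∞ :=
  ⨅ (γ : ℝ → Fin n → ℝ) (_ : ContDiffOn ℝ 1 γ (Icc 0 1)) (_ : MapsTo γ (Icc 0 1) U)
    (_ : γ 0 = x) (_ : γ 1 = y), curveLength g γ

/-- The Riemannian manifold `(U, g)` is complete: every sequence in `U` which is Cauchy for the
Riemannian distance converges, for that distance, to a point of `U`. -/
def IsCompleteOn (g : (Fin n → ℝ) → Matrix (Fin n) (Fin n) ℝ) (U : Set (Fin n → ℝ)) : Prop :=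
  ∀ u : ℕ → Fin n → ℝ, (∀ k, u k ∈ U) →
    (∀ ε : ℝ≥0∞, 0 < ε → ∃ N, ∀ k ≥ N, ∀ l ≥ N, riemDist g U (u k) (u l) < ε) →
    ∃ x ∈ U, Tendsto (fun k => riemDist g U (u k) x) atTop (𝓝 0)

end CoordGeom

/-- The components at `x = (ρ, φ, ζ̃, ζ)` of the one-form `dφ + ζ dζ̃ - ζ̃ dζ`. -/
def etaUH (x : Fin 4 → ℝ) : Fin 4 → ℝ := ![0, 1, x 3, -x 2]

/-- The one-loop deformed universal hypermultiplet metric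
`1/(4ρ²) ((ρ+2c)/(ρ+c) dρ² + (ρ+c)/(ρ+2c) (dφ + ζ dζ̃ - ζ̃ dζ)² + 2(ρ+2c) (dζ̃² + dζ²))`
in the coordinates `x = (ρ, φ, ζ̃, ζ)` of `ℝ⁴`. -/
def gUH (c : ℝ) (x : Fin 4 → ℝ) : Matrix (Fin 4) (Fin 4) ℝ :=
  (1 / (4 * x 0 ^ 2)) •
    (((x 0 + 2 * c) / (x 0 + c)) • Matrix.vecMulVec (Pi.single 0 1) (Pi.single 0 1)
      + ((x 0 + c) / (x 0 + 2 * c)) • Matrix.vecMulVec (etaUH x) (etaUH x)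
      + (2 * (x 0 + 2 * c)) • (Matrix.vecMulVec (Pi.single 2 1) (Pi.single 2 1)
          + Matrix.vecMulVec (Pi.single 3 1) (Pi.single 3 1)))

end

/-! The metric is diagonal in the one-forms `dρ, η, dζ̃, dζ`, where `η = dφ + ζ dζ̃ - ζ̃ dζ`.
Factoring out `conf` leaves a coframe that involves only the square root of `ρ + c`. As `ρ + c` is
positive on all four domains, a single computation with `σ • gUH c`, `σ = ±1`, covers them all.

Geometry. Since `so(4) = sp(1) ⊕ sp(1)`, the connection form in this coframe is an exact multiple of
the identity plus parts along two commuting quaternion triples `unitQ` and `unitC`. It is identified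
through the torsion equation (`connForm_torsion`). The span of the `unitQ` triple is therefore
parallel. The curvature of the `unitQ`-part is the same constant multiple of the fundamental
two-form for each unit (`structure_coefQ`), while the `unitC`-part has the eigenvalues `curvC`,
which vary with `ρ` but always sum to `-3` (`structure_coefC`). Equal coefficients give the
curvature identity on `unitQ`, and the `unitC`-part commutes with it (`annihilates_kahlerTensor`).
Each summand contracts to a multiple of the metric, so the metric is Einstein, with scalar curvature
`-24 / σ`.

Incompleteness. A radial curve reaches a boundary value of `ρ` in finite length, and a Lipschitz
function of `ρ` has a limit along it that is not attained in the domain (`not_isCompleteOn_gUH`).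

Completeness for `c > 0`, `ρ > 0`. The function `log ρ` is Lipschitz, so curves of bounded length
keep `ρ` between positive bounds; there the other coordinates are controlled too. A Cauchy sequence
is thus Cauchy in the coordinates, with limit inside the domain (`isCompleteOn_gUH`). -/

noncomputable section

namespace CoordGeom

variable {n : ℕ}

/-! ### Partial derivatives of matrix-valued functions -/

/-- The entries of `A` are smooth on `U`. -/
def SmoothOn (A : (Fin n → ℝ) → Matrix (Fin n) (Fin n) ℝ) (U : Set (Fin n → ℝ)) : Prop :=
  ∀ i j, ContDiffOn ℝ ∞ (fun x => A x i j) U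

lemma contDiffOn_pderiv {f : (Fin n → ℝ) → ℝ} {U : Set (Fin n → ℝ)} (hU : IsOpen U)
    (hf : ContDiffOn ℝ ∞ f U) (i : Fin n) : ContDiffOn ℝ ∞ (pderiv i f) U :=
  (hf.fderiv_of_isOpen hU (by simp)).clm_apply contDiffOn_const

lemma pderiv_comm {f : (Fin n → ℝ) → ℝ} {U : Set (Fin n → ℝ)} (hU : IsOpen U)
    (hf : ContDiffOn ℝ ∞ f U) (i j : Fin n) {x : Fin n → ℝ} (hx : x ∈ U) :
    pderiv i (pderiv j f) x = pderiv j (pderiv i f) x := by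
  have hf' : DifferentiableAt ℝ (fderiv ℝ f) x :=
    ((hf.fderiv_of_isOpen hU (m := ∞) (by simp)).contDiffAt (hU.mem_nhds hx)).differentiableAt
      (by simp)
  have key : ∀ k l : Fin n, pderiv k (pderiv l f) x =
      fderiv ℝ (fderiv ℝ f) x (Pi.single k 1) (Pi.single l 1) := by
    intro k l
    unfold pderiv
    rw [fderiv_clm_apply hf' (differentiableAt_const _)]
    simp
  rw [key, key]
  exact ((hf.contDiffAt (hU.mem_nhds hx)).isSymmSndFDerivAt
    (by simpa using WithTop.coe_le_coe.2 (le_top : (2 : ℕ∞) ≤ ⊤))) _ _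

lemma SmoothOn.matPderiv {A : (Fin n → ℝ) → Matrix (Fin n) (Fin n) ℝ} {U : Set (Fin n → ℝ)}
    (hU : IsOpen U) (hA : SmoothOn A U) (i : Fin n) : SmoothOn (matPderiv i A) U :=
  fun k j => contDiffOn_pderiv hU (hA k j) i

lemma SmoothOn.mul {A B : (Fin n → ℝ) → Matrix (Fin n) (Fin n) ℝ} {U : Set (Fin n → ℝ)}
    (hA : SmoothOn A U) (hB : SmoothOn B U) : SmoothOn (fun x => A x * B x) U := by
  intro i j
  simp only [Matrix.mul_apply]
  exact ContDiffOn.sum fun k _ => (hA i k).mul (hB k j)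

lemma SmoothOn.add {A B : (Fin n → ℝ) → Matrix (Fin n) (Fin n) ℝ} {U : Set (Fin n → ℝ)}
    (hA : SmoothOn A U) (hB : SmoothOn B U) : SmoothOn (fun x => A x + B x) U :=
  fun i j => (hA i j).add (hB i j)

lemma SmoothOn.smul {f : (Fin n → ℝ) → ℝ} {A : (Fin n → ℝ) → Matrix (Fin n) (Fin n) ℝ}
    {U : Set (Fin n → ℝ)} (hf : ContDiffOn ℝ ∞ f U) (hA : SmoothOn A U) :
    SmoothOn (fun x => f x • A x) U :=
  fun i j => hf.mul (hA i j)

lemma SmoothOn.transpose {A : (Fin n → ℝ) → Matrix (Fin n) (Fin n) ℝ} {U : Set (Fin n → ℝ)}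
    (hA : SmoothOn A U) : SmoothOn (fun x => (A x)ᵀ) U :=
  fun i j => hA j i

lemma smoothOn_const (A : Matrix (Fin n) (Fin n) ℝ) (U : Set (Fin n → ℝ)) :
    SmoothOn (fun _ => A) U :=
  fun _ _ => contDiffOn_const

lemma SmoothOn.differentiableAt {A : (Fin n → ℝ) → Matrix (Fin n) (Fin n) ℝ}
    {U : Set (Fin n → ℝ)} (hA : SmoothOn A U) (hU : IsOpen U) {x : Fin n → ℝ} (hx : x ∈ U)
    (i j : Fin n) : DifferentiableAt ℝ (fun y => A y i j) x :=
  ((hA i j).contDiffAt (hU.mem_nhds hx)).differentiableAt (by simp)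

lemma matPderiv_congr {A B : (Fin n → ℝ) → Matrix (Fin n) (Fin n) ℝ} {U : Set (Fin n → ℝ)}
    (hU : IsOpen U) (h : ∀ x ∈ U, A x = B x) (i : Fin n) {x : Fin n → ℝ} (hx : x ∈ U) :
    matPderiv i A x = matPderiv i B x := by
  ext k j
  simp only [matPderiv, pderiv, Matrix.of_apply]
  rw [Filter.EventuallyEq.fderiv_eq]
  filter_upwards [hU.mem_nhds hx] with y hy
  rw [h y hy]

lemma matPderiv_mul {A B : (Fin n → ℝ) → Matrix (Fin n) (Fin n) ℝ} {U : Set (Fin n → ℝ)}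
    (hU : IsOpen U) (hA : SmoothOn A U) (hB : SmoothOn B U) (i : Fin n) {x : Fin n → ℝ}
    (hx : x ∈ U) :
    matPderiv i (fun y => A y * B y) x = matPderiv i A x * B x + A x * matPderiv i B x := by
  ext k j
  simp only [matPderiv, pderiv, Matrix.of_apply, Matrix.add_apply, Matrix.mul_apply]
  have hd : ∀ l ∈ Finset.univ, DifferentiableAt ℝ (fun y => A y k l * B y l j) x := fun l _ =>
    (hA.differentiableAt hU hx k l).mul (hB.differentiableAt hU hx l j)
  rw [fderiv_fun_sum hd]
  rw [sum_apply, ← Finset.sum_add_distrib]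
  refine Finset.sum_congr rfl fun l _ => ?_
  rw [fderiv_fun_mul (hA.differentiableAt hU hx k l) (hB.differentiableAt hU hx l j)]
  simp
  ring

lemma matPderiv_add {A B : (Fin n → ℝ) → Matrix (Fin n) (Fin n) ℝ} {U : Set (Fin n → ℝ)}
    (hU : IsOpen U) (hA : SmoothOn A U) (hB : SmoothOn B U) (i : Fin n) {x : Fin n → ℝ}
    (hx : x ∈ U) :
    matPderiv i (fun y => A y + B y) x = matPderiv i A x + matPderiv i B x := by
  ext k j
  simp only [matPderiv, pderiv, Matrix.of_apply, Matrix.add_apply]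
  rw [fderiv_fun_add (hA.differentiableAt hU hx k j) (hB.differentiableAt hU hx k j)]
  simp

lemma matPderiv_smul {f : (Fin n → ℝ) → ℝ} {A : (Fin n → ℝ) → Matrix (Fin n) (Fin n) ℝ}
    {x : Fin n → ℝ} (hf : DifferentiableAt ℝ f x)
    (hA : ∀ k j, DifferentiableAt ℝ (fun y => A y k j) x) (i : Fin n) :
    matPderiv i (fun y => f y • A y) x = pderiv i f x • A x + f x • matPderiv i A x := by
  ext k j
  simp only [matPderiv, pderiv, Matrix.of_apply, Matrix.add_apply, Matrix.smul_apply, smul_eq_mul]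
  rw [fderiv_fun_mul hf (hA k j)]
  simp
  ring

lemma matPderiv_transpose (A : (Fin n → ℝ) → Matrix (Fin n) (Fin n) ℝ) (i : Fin n)
    (x : Fin n → ℝ) : matPderiv i (fun y => (A y)ᵀ) x = (matPderiv i A x)ᵀ := rfl

lemma matPderiv_const (A : Matrix (Fin n) (Fin n) ℝ) (i : Fin n) (x : Fin n → ℝ) :
    matPderiv i (fun _ => A) x = 0 := by
  ext k j
  simp [matPderiv, pderiv]

lemma matPderiv_comm {A : (Fin n → ℝ) → Matrix (Fin n) (Fin n) ℝ} {U : Set (Fin n → ℝ)}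
    (hU : IsOpen U) (hA : SmoothOn A U) (i j : Fin n) {x : Fin n → ℝ} (hx : x ∈ U) :
    matPderiv i (matPderiv j A) x = matPderiv j (matPderiv i A) x := by
  ext k l
  exact pderiv_comm hU (hA k l) i j hx

/-! ### The Levi-Civita connection in a moving frame -/

/-- The fundamental lemma: a symmetric metric connection has the Christoffel symbols as its
connection coefficients. -/
lemma christoffel_eq {g : (Fin n → ℝ) → Matrix (Fin n) (Fin n) ℝ} {x : Fin n → ℝ}
    (hg : (g x)ᵀ = g x) (hdet : IsUnit (g x).det) {G : Fin n → Matrix (Fin n) (Fin n) ℝ}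
    (hsymm : ∀ i j k, G i k j = G j k i)
    (hmet : ∀ i, matPderiv i g x = (G i)ᵀ * g x + g x * G i) (i : Fin n) :
    christoffel g i x = G i := by
  have hd : ∀ i j l, pderiv i (fun y => g y j l) x = (g x * G i) l j + (g x * G i) j l := by
    intro i j l
    have h := congrFun (congrFun (hmet i) j) l
    have h2 : (G i)ᵀ * g x = (g x * G i)ᵀ := by rw [Matrix.transpose_mul, hg]
    rw [h2] at h
    exact h
  have hs : ∀ i j l, (g x * G i) l j = (g x * G j) l i := by
    intro i j l
    simp only [Matrix.mul_apply]
    exact Finset.sum_congr rfl fun k _ => by rw [hsymm]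
  have hG : G i = (g x)⁻¹ * (g x * G i) := by
    rw [← Matrix.mul_assoc, Matrix.nonsing_inv_mul _ hdet, Matrix.one_mul]
  ext k j
  conv_rhs => rw [hG, Matrix.mul_apply]
  simp only [christoffel, Matrix.of_apply]
  rw [Finset.mul_sum]
  refine Finset.sum_congr rfl fun l _ => ?_
  rw [hd, hd, hd, hs j i l, hs j l i, hs i l j]
  ring

/-- `F` is a smooth coframe over the open set `U`, with inverse `N`, in which the Levi-Civita
connection of `g` has the connection form `w`. -/
structure IsConnectionFormOn (g : (Fin n → ℝ) → Matrix (Fin n) (Fin n) ℝ) (U : Set (Fin n → ℝ))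
    (F N : (Fin n → ℝ) → Matrix (Fin n) (Fin n) ℝ)
    (w : Fin n → (Fin n → ℝ) → Matrix (Fin n) (Fin n) ℝ) : Prop where
  isOpen : IsOpen U
  smooth_coframe : SmoothOn F U
  smooth_inv : SmoothOn N U
  smooth_form : ∀ i, SmoothOn (w i) U
  mul_inv : ∀ x ∈ U, F x * N x = 1
  inv_mul : ∀ x ∈ U, N x * F x = 1
  coframe_mul_christoffel : ∀ i, ∀ x ∈ U,
    F x * christoffel g i x = w i x * F x + matPderiv i F x

namespace IsConnectionFormOn

variable {g F N : (Fin n → ℝ) → Matrix (Fin n) (Fin n) ℝ} {U : Set (Fin n → ℝ)}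
  {w : Fin n → (Fin n → ℝ) → Matrix (Fin n) (Fin n) ℝ}

lemma christoffel_eq (h : IsConnectionFormOn g U F N w) (i : Fin n) {x : Fin n → ℝ}
    (hx : x ∈ U) : christoffel g i x = N x * (w i x * F x + matPderiv i F x) := by
  rw [← h.coframe_mul_christoffel i x hx, ← Matrix.mul_assoc, h.inv_mul x hx, Matrix.one_mul]

lemma smoothOn_christoffel (h : IsConnectionFormOn g U F N w) (i : Fin n) :
    SmoothOn (christoffel g i) U := by
  have h1 : SmoothOn (fun x => N x * (w i x * F x + matPderiv i F x)) U :=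
    h.smooth_inv.mul (((h.smooth_form i).mul h.smooth_coframe).add
      (h.smooth_coframe.matPderiv h.isOpen i))
  intro k j
  refine (h1 k j).congr fun x hx => ?_
  rw [h.christoffel_eq i hx]

/-- Cartan's second structure equation. -/
lemma curvature_eq (h : IsConnectionFormOn g U F N w) (i j : Fin n) {x : Fin n → ℝ}
    (hx : x ∈ U) :
    curvature g i j x = N x * (matPderiv i (w j) x - matPderiv j (w i) x
      + (w i x * w j x - w j x * w i x)) * F x := by
  -- Differentiate the gauge relation `F Γ_j = w_j F + ∂_j F`. After antisymmetrizing in `i, j` the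
  -- second derivatives of `F` cancel by `h5`.
  have hd : ∀ i j, matPderiv i F x * christoffel g j x + F x * matPderiv i (christoffel g j) x =
      matPderiv i (w j) x * F x + w j x * matPderiv i F x + matPderiv i (matPderiv j F) x := by
    intro i j
    rw [← matPderiv_mul h.isOpen h.smooth_coframe (h.smoothOn_christoffel j) i hx,
      matPderiv_congr h.isOpen (h.coframe_mul_christoffel j) i hx,
      matPderiv_add h.isOpen ((h.smooth_form j).mul h.smooth_coframe)
        (h.smooth_coframe.matPderiv h.isOpen j) i hx,
      matPderiv_mul h.isOpen (h.smooth_form j) h.smooth_coframe i hx]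
  have h1 := hd i j
  have h2 := hd j i
  have h3 := h.coframe_mul_christoffel i x hx
  have h4 := h.coframe_mul_christoffel j x hx
  have h5 := matPderiv_comm h.isOpen h.smooth_coframe i j hx
  have key : F x * curvature g i j x = (matPderiv i (w j) x - matPderiv j (w i) x
      + (w i x * w j x - w j x * w i x)) * F x := by
    have e1 : F x * matPderiv i (christoffel g j) x = matPderiv i (w j) x * F x
        + w j x * matPderiv i F x + matPderiv i (matPderiv j F) x
        - matPderiv i F x * christoffel g j x := by rw [← h1]; abel
    have e2 : F x * matPderiv j (christoffel g i) x = matPderiv j (w i) x * F x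
        + w i x * matPderiv j F x + matPderiv i (matPderiv j F) x
        - matPderiv j F x * christoffel g i x := by rw [h5, ← h2]; abel
    unfold curvature
    rw [Matrix.mul_add, Matrix.mul_sub, Matrix.mul_sub, e1, e2, ← Matrix.mul_assoc,
      ← Matrix.mul_assoc, h3, h4, Matrix.add_mul, Matrix.add_mul, Matrix.mul_assoc (w i x),
      Matrix.mul_assoc (w j x), h3, h4]
    noncomm_ring
  rw [Matrix.mul_assoc, ← key, ← Matrix.mul_assoc, h.inv_mul x hx, Matrix.one_mul]

lemma matPderiv_inv (h : IsConnectionFormOn g U F N w) (i : Fin n) {x : Fin n → ℝ}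
    (hx : x ∈ U) : matPderiv i N x = -(N x * matPderiv i F x * N x) := by
  have h1 := matPderiv_mul h.isOpen h.smooth_inv h.smooth_coframe i hx
  rw [matPderiv_congr h.isOpen h.inv_mul i hx, matPderiv_const] at h1
  have h2 : matPderiv i N x * F x = -(N x * matPderiv i F x) :=
    eq_neg_of_add_eq_zero_left h1.symm
  calc matPderiv i N x = matPderiv i N x * F x * N x := by
        rw [Matrix.mul_assoc, h.mul_inv x hx, Matrix.mul_one]
    _ = _ := by rw [h2, Matrix.neg_mul]

/-- The covariant derivative of an endomorphism field with constant components in the coframe. -/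
lemma covDerivEnd_conj (h : IsConnectionFormOn g U F N w) (A : Matrix (Fin n) (Fin n) ℝ)
    (i : Fin n) {x : Fin n → ℝ} (hx : x ∈ U) :
    covDerivEnd g i (fun y => N y * A * F y) x =
      N x * (w i x * A - A * w i x) * F x := by
  unfold covDerivEnd
  rw [matPderiv_mul h.isOpen (h.smooth_inv.mul (smoothOn_const A U)) h.smooth_coframe i hx,
    matPderiv_mul h.isOpen h.smooth_inv (smoothOn_const A U) i hx, matPderiv_const,
    h.matPderiv_inv i hx, h.christoffel_eq i hx]
  have e1 : N x * (w i x * F x + matPderiv i F x) * (N x * A * F x) =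
      N x * w i x * (F x * N x) * A * F x + N x * matPderiv i F x * N x * A * F x := by
    noncomm_ring
  have e2 : N x * A * F x * (N x * (w i x * F x + matPderiv i F x)) =
      N x * A * (F x * N x) * (w i x * F x + matPderiv i F x) := by
    noncomm_ring
  rw [e1, e2, h.mul_inv x hx]
  noncomm_ring

end IsConnectionFormOn

/-- Cartan's first structure equation for the metric with conformally orthonormal coframe `F`. -/
lemma isConnectionFormOn_of_conformal {g F N : (Fin n → ℝ) → Matrix (Fin n) (Fin n) ℝ}
    {U : Set (Fin n → ℝ)} {w : Fin n → (Fin n → ℝ) → Matrix (Fin n) (Fin n) ℝ}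
    {f : (Fin n → ℝ) → ℝ} {θ : Fin n → (Fin n → ℝ) → ℝ} (hU : IsOpen U) (hF : SmoothOn F U)
    (hN : SmoothOn N U) (hw : ∀ i, SmoothOn (w i) U) (hf : ContDiffOn ℝ ∞ f U)
    (hf0 : ∀ x ∈ U, f x ≠ 0) (hg : ∀ x ∈ U, g x = f x • ((F x)ᵀ * F x))
    (hFN : ∀ x ∈ U, F x * N x = 1) (hθ : ∀ i, ∀ x ∈ U, pderiv i f x = f x * θ i x)
    (hskew : ∀ i, ∀ x ∈ U, w i x + (w i x)ᵀ = θ i x • 1)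
    (htorsion : ∀ x ∈ U, ∀ i j k,
      (w i x * F x + matPderiv i F x) k j = (w j x * F x + matPderiv j F x) k i) :
    IsConnectionFormOn g U F N w where
  isOpen := hU
  smooth_coframe := hF
  smooth_inv := hN
  smooth_form := hw
  mul_inv := hFN
  inv_mul x hx := mul_eq_one_comm.1 (hFN x hx)
  coframe_mul_christoffel i x hx := by
    have hFN' := hFN x hx
    have hNF : N x * F x = 1 := mul_eq_one_comm.1 hFN'
    have hgs : (g x)ᵀ = g x := by
      rw [hg x hx, Matrix.transpose_smul, Matrix.transpose_mul, Matrix.transpose_transpose]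
    have hdet : IsUnit (g x).det := by
      rw [hg x hx, Matrix.det_smul, Matrix.det_mul, Matrix.det_transpose]
      have h1 : (F x).det ≠ 0 := fun h0 => by
        have := congrArg Matrix.det hFN'
        rw [Matrix.det_mul, h0, zero_mul, Matrix.det_one] at this
        exact zero_ne_one this
      exact (mul_ne_zero (pow_ne_zero _ (hf0 x hx)) (mul_ne_zero h1 h1)).isUnit
    -- The candidate is the gauge transform of `w`. By uniqueness of the Levi-Civita connection it
    -- remains to check symmetry, which is `htorsion`, and metricity, where the symmetric part of
    -- `w` accounts for the derivative of the conformal factor.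
    have key := christoffel_eq hgs hdet
      (G := fun i => N x * (w i x * F x + matPderiv i F x)) ?_ ?_ i
    · rw [key, ← Matrix.mul_assoc, hFN', Matrix.one_mul]
    · intro i j k
      simp only [Matrix.mul_apply (M := N x)]
      exact Finset.sum_congr rfl fun l _ => by rw [htorsion x hx]
    · intro i
      have h1 : ∀ T : Matrix (Fin n) (Fin n) ℝ,
          (N x * T)ᵀ * g x + g x * (N x * T) = f x • (Tᵀ * F x + (F x)ᵀ * T) := by
        intro T
        have e1 : (N x * T)ᵀ * ((F x)ᵀ * F x) = Tᵀ * (F x * N x)ᵀ * F x := by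
          simp only [Matrix.transpose_mul]
          noncomm_ring
        have e2 : (F x)ᵀ * F x * (N x * T) = (F x)ᵀ * (F x * N x) * T := by noncomm_ring
        rw [hg x hx, Matrix.mul_smul, Matrix.smul_mul, e1, e2, hFN', ← smul_add,
          Matrix.transpose_one, Matrix.mul_one, Matrix.mul_one]
      have hd := hF.transpose.mul hF
      rw [h1, matPderiv_congr hU hg i hx, matPderiv_smul
        ((hf.contDiffAt (hU.mem_nhds hx)).differentiableAt (by simp))
        (fun k j => hd.differentiableAt hU hx k j), matPderiv_mul hU hF.transpose hF i hx,
        matPderiv_transpose, hθ i x hx]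
      have e3 : (w i x * F x + matPderiv i F x)ᵀ * F x + (F x)ᵀ * (w i x * F x + matPderiv i F x) =
          (F x)ᵀ * (w i x + (w i x)ᵀ) * F x
            + ((matPderiv i F x)ᵀ * F x + (F x)ᵀ * matPderiv i F x) := by
        simp only [Matrix.transpose_add, Matrix.transpose_mul]
        noncomm_ring
      rw [e3, hskew i x hx]
      simp only [Matrix.mul_smul, Matrix.smul_mul, Matrix.mul_one, smul_add, mul_smul]

/-! ### Pointwise algebra of quaternionic curvature tensors -/

/-- The quaternionic relations for a triple of matrices. -/
structure IsQuaternionTriple (J : Fin 3 → Matrix (Fin n) (Fin n) ℝ) : Prop where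
  sq_zero : J 0 * J 0 = -1
  sq_one : J 1 * J 1 = -1
  mul_eq : J 0 * J 1 = J 2
  anticomm : J 1 * J 0 = -J 2

namespace IsQuaternionTriple

variable {J : Fin 3 → Matrix (Fin n) (Fin n) ℝ}

lemma zero_mul_two (h : IsQuaternionTriple J) : J 0 * J 2 = -J 1 := by
  rw [← h.mul_eq, ← Matrix.mul_assoc, h.sq_zero, Matrix.neg_mul, Matrix.one_mul]

lemma two_mul_zero (h : IsQuaternionTriple J) : J 2 * J 0 = J 1 := by
  rw [← neg_neg (J 2), ← h.anticomm, Matrix.neg_mul, Matrix.mul_assoc, h.sq_zero, Matrix.mul_neg,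
    Matrix.mul_one, neg_neg]

lemma one_mul_two (h : IsQuaternionTriple J) : J 1 * J 2 = J 0 := by
  rw [← neg_neg (J 2), ← h.anticomm, Matrix.mul_neg, ← Matrix.mul_assoc, h.sq_one, Matrix.neg_mul,
    Matrix.one_mul, neg_neg]

lemma two_mul_one (h : IsQuaternionTriple J) : J 2 * J 1 = -J 0 := by
  rw [← h.mul_eq, Matrix.mul_assoc, h.sq_one, Matrix.mul_neg, Matrix.mul_one]

lemma sq_two (h : IsQuaternionTriple J) : J 2 * J 2 = -1 := by
  nth_rw 1 [← h.mul_eq]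
  rw [Matrix.mul_assoc, h.one_mul_two, h.sq_zero]

lemma sq (h : IsQuaternionTriple J) (k : Fin 3) : J k * J k = -1 := by
  fin_cases k
  exacts [h.sq_zero, h.sq_one, h.sq_two]

lemma conj (h : IsQuaternionTriple J) {F N : Matrix (Fin n) (Fin n) ℝ} (h1 : F * N = 1) :
    IsQuaternionTriple fun k => N * J k * F := by
  have h2 : N * F = 1 := mul_eq_one_comm.1 h1
  have key : ∀ A B : Matrix (Fin n) (Fin n) ℝ, N * A * F * (N * B * F) = N * (A * B) * F := by
    intro A B
    calc _ = N * A * (F * N) * B * F := by noncomm_ring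
      _ = _ := by rw [h1]; noncomm_ring
  constructor <;> simp only [key, h.sq_zero, h.sq_one, h.mul_eq, h.anticomm] <;> simp [h2]

end IsQuaternionTriple

lemma sum_smul_pair (A B : Matrix (Fin n) (Fin n) ℝ) (i j : Fin n) :
    ∑ m, (A m i * B m j + A m j * B i m) = (Aᵀ * B + B * A) i j := by
  simp only [Matrix.add_apply, Matrix.mul_apply, Matrix.transpose_apply]
  rw [← Finset.sum_add_distrib]
  exact Finset.sum_congr rfl fun m _ => by ring

/-- The curvature-like tensor `∑ k, a k (g J_k) ⊗ J_k`. -/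
def kahlerTensor (g : Matrix (Fin n) (Fin n) ℝ) (J : Fin 3 → Matrix (Fin n) (Fin n) ℝ)
    (a : Fin 3 → ℝ) (i j : Fin n) : Matrix (Fin n) (Fin n) ℝ :=
  ∑ k, (a k * (g * J k) i j) • J k

/-- For `A` skew with respect to `g`, letting `A` act on both slots of the two-form `g J_k` yields
`g [J_k, A]`. The curvature identity thereby becomes a statement about commutators. -/
lemma sum_smul_kahlerTensor (g : Matrix (Fin n) (Fin n) ℝ)
    (J : Fin 3 → Matrix (Fin n) (Fin n) ℝ) (a : Fin 3 → ℝ) {A : Matrix (Fin n) (Fin n) ℝ}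
    (hA : Aᵀ * g + g * A = 0) (i j : Fin n) :
    ∑ m, (A m i • kahlerTensor g J a m j + A m j • kahlerTensor g J a i m) =
      ∑ k, (a k * (g * (J k * A - A * J k)) i j) • J k := by
  simp only [kahlerTensor, Finset.smul_sum, ← Finset.sum_add_distrib]
  rw [Finset.sum_comm]
  refine Finset.sum_congr rfl fun k _ => ?_
  have h1 : g * (J k * A - A * J k) = Aᵀ * (g * J k) + g * J k * A := by
    rw [Matrix.mul_sub, ← Matrix.mul_assoc, ← Matrix.mul_assoc, ← Matrix.mul_assoc,
      eq_neg_of_add_eq_zero_left hA, Matrix.neg_mul]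
    abel
  rw [h1, ← sum_smul_pair, Finset.mul_sum, Finset.sum_smul]
  refine Finset.sum_congr rfl fun m _ => ?_
  rw [smul_smul, smul_smul, ← add_smul]
  congr 1
  ring

/-- Both sides vanish, whatever the coefficients are. -/
lemma kahlerTensor_of_commute (g : Matrix (Fin n) (Fin n) ℝ)
    {P : Fin 3 → Matrix (Fin n) (Fin n) ℝ} (a : Fin 3 → ℝ) {A : Matrix (Fin n) (Fin n) ℝ}
    (hA : Aᵀ * g + g * A = 0) (hP : ∀ k, A * P k = P k * A) (i j : Fin n) :
    A * kahlerTensor g P a i j - kahlerTensor g P a i j * A =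
      ∑ m, (A m i • kahlerTensor g P a m j + A m j • kahlerTensor g P a i m) := by
  rw [sum_smul_kahlerTensor g P a hA]
  simp [kahlerTensor, Matrix.mul_sum, Matrix.sum_mul, hP]

/-- This is the invariance of the Casimir element `∑ J_k ⊗ J_k` of `sp(1)` under the adjoint action;
it needs the coefficients to be equal. -/
lemma kahlerTensor_of_quaternion (g : Matrix (Fin n) (Fin n) ℝ)
    {J : Fin 3 → Matrix (Fin n) (Fin n) ℝ} (hJ : IsQuaternionTriple J)
    (hg : ∀ k, (J k)ᵀ * g + g * J k = 0) (a : ℝ) (l : Fin 3) (i j : Fin n) :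
    J l * kahlerTensor g J (fun _ => a) i j - kahlerTensor g J (fun _ => a) i j * J l =
      ∑ m, (J l m i • kahlerTensor g J (fun _ => a) m j
        + J l m j • kahlerTensor g J (fun _ => a) i m) := by
  rw [sum_smul_kahlerTensor g J _ (hg l)]
  fin_cases l <;>
  · simp only [kahlerTensor, Fin.sum_univ_three, Matrix.mul_add, Matrix.add_mul, Matrix.mul_smul,
      Matrix.smul_mul, hJ.sq, hJ.mul_eq, hJ.anticomm, hJ.zero_mul_two, hJ.two_mul_zero,
      hJ.one_mul_two, hJ.two_mul_one, Fin.zero_eta, Fin.mk_one, Fin.reduceFinMk, Matrix.mul_sub,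
      Matrix.mul_neg, Matrix.sub_apply, Matrix.neg_apply, Matrix.mul_one]
    module

lemma annihilates_kahlerTensor {g : Matrix (Fin n) (Fin n) ℝ}
    {J P : Fin 3 → Matrix (Fin n) (Fin n) ℝ} (hJ : IsQuaternionTriple J)
    (hg : ∀ k, (J k)ᵀ * g + g * J k = 0) (hP : ∀ k l, J k * P l = P l * J k) (a : ℝ)
    (b : Fin 3 → ℝ) {A : Matrix (Fin n) (Fin n) ℝ}
    (hA : A ∈ Submodule.span ℝ (Set.range J)) (i j : Fin n) :
    A * (kahlerTensor g J (fun _ => a) i j + kahlerTensor g P b i j)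
        - (kahlerTensor g J (fun _ => a) i j + kahlerTensor g P b i j) * A =
      ∑ m, (A m i • (kahlerTensor g J (fun _ => a) m j + kahlerTensor g P b m j)
        + A m j • (kahlerTensor g J (fun _ => a) i m + kahlerTensor g P b i m)) := by
  induction hA using Submodule.span_induction with
  | mem A hA =>
    obtain ⟨l, rfl⟩ := hA
    have h1 := kahlerTensor_of_quaternion g hJ hg a l i j
    have h2 := kahlerTensor_of_commute g b (hg l) (hP l) i j
    simp only [smul_add, Finset.sum_add_distrib] at h1 h2 ⊢
    rw [Matrix.mul_add, Matrix.add_mul, add_sub_add_comm, h1, h2]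
    abel
  | zero => simp
  | add A B _ _ hA hB =>
    rw [Matrix.add_mul A B, Matrix.mul_add _ A B, add_sub_add_comm, hA, hB, ← Finset.sum_add_distrib]
    refine Finset.sum_congr rfl fun m _ => ?_
    simp only [Matrix.add_apply, add_smul]
    abel
  | smul r A _ hA =>
    rw [Matrix.smul_mul, Matrix.mul_smul, ← smul_sub, hA, Finset.smul_sum]
    refine Finset.sum_congr rfl fun m _ => ?_
    simp only [Matrix.smul_apply, smul_add, smul_smul, smul_eq_mul]

/-- Skewness and `J_k² = -1` make each summand contract to a multiple of `g`, so the tensor is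
Einstein even with unequal coefficients. -/
lemma ricci_kahlerTensor {g : Matrix (Fin n) (Fin n) ℝ} (hg : gᵀ = g)
    {J : Fin 3 → Matrix (Fin n) (Fin n) ℝ} (hJ : ∀ k, J k * J k = -1)
    (hJg : ∀ k, (J k)ᵀ * g + g * J k = 0) (a : Fin 3 → ℝ) (j k : Fin n) :
    ∑ i, kahlerTensor g J a i j i k = (∑ l, a l) * g j k := by
  have h : ∀ l, ∑ i, (g * J l) i j * J l i k = g j k := by
    intro l
    have h1 : (g * J l)ᵀ * J l = g := by
      rw [Matrix.transpose_mul, hg, eq_neg_of_add_eq_zero_left (hJg l), Matrix.neg_mul,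
        Matrix.mul_assoc, hJ, Matrix.mul_neg, neg_neg, Matrix.mul_one]
    exact congrFun (congrFun h1 j) k
  simp only [kahlerTensor, Matrix.sum_apply, Matrix.smul_apply, smul_eq_mul]
  rw [Finset.sum_comm, Finset.sum_mul]
  refine Finset.sum_congr rfl fun l _ => ?_
  rw [← h l, Finset.mul_sum]
  exact Finset.sum_congr rfl fun i _ => by ring

lemma scalarCurvature_eq {g : (Fin n → ℝ) → Matrix (Fin n) (Fin n) ℝ} {x : Fin n → ℝ}
    (hg : (g x)ᵀ = g x) (hdet : IsUnit (g x).det) {J P : Fin 3 → Matrix (Fin n) (Fin n) ℝ}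
    (hJ : ∀ k, J k * J k = -1) (hJg : ∀ k, (J k)ᵀ * g x + g x * J k = 0)
    (hP : ∀ k, P k * P k = -1) (hPg : ∀ k, (P k)ᵀ * g x + g x * P k = 0) {a b : Fin 3 → ℝ}
    (hR : ∀ i j, curvature g i j x = kahlerTensor (g x) J a i j + kahlerTensor (g x) P b i j) :
    scalarCurvature g x = n * (∑ l, a l + ∑ l, b l) := by
  have h1 : ∀ j k, ricci g x j k = (∑ l, a l + ∑ l, b l) * g x j k := by
    intro j k
    simp only [ricci, Matrix.of_apply, hR, Matrix.add_apply, Finset.sum_add_distrib]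
    rw [ricci_kahlerTensor hg hJ hJg, ricci_kahlerTensor hg hP hPg, add_mul]
  have h2 : ∀ j, ∑ k, (g x)⁻¹ j k * g x j k = 1 := by
    intro j
    have := congrFun (congrFun (Matrix.nonsing_inv_mul _ hdet) j) j
    rw [Matrix.mul_apply, Matrix.one_apply_eq] at this
    rw [← this]
    exact Finset.sum_congr rfl fun k _ => by rw [← Matrix.transpose_apply (g x) k j, hg]
  simp only [scalarCurvature, h1]
  calc _ = ∑ j, (∑ l, a l + ∑ l, b l) * ∑ k, (g x)⁻¹ j k * g x j k := by
        refine Finset.sum_congr rfl fun j _ => ?_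
        rw [Finset.mul_sum]
        exact Finset.sum_congr rfl fun k _ => by ring
    _ = _ := by simp [h2, mul_add]

/-- The curvature of a connection form with values in two commuting copies of `sp(1)`. -/
lemma commutator_quaternion {J P : Fin 3 → Matrix (Fin n) (Fin n) ℝ} (hJ : IsQuaternionTriple J)
    (hP : IsQuaternionTriple P) (hJP : ∀ k l, J k * P l = P l * J k) (f f' : ℝ)
    (a a' b b' : Fin 3 → ℝ) :
    (f • 1 + ∑ k, a k • J k + ∑ k, b k • P k) * (f' • 1 + ∑ k, a' k • J k + ∑ k, b' k • P k)
      - (f' • 1 + ∑ k, a' k • J k + ∑ k, b' k • P k)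
        * (f • 1 + ∑ k, a k • J k + ∑ k, b k • P k) =
      ∑ k, (2 * (a (k + 1) * a' (k + 2) - a (k + 2) * a' (k + 1))) • J k
        + ∑ k, (2 * (b (k + 1) * b' (k + 2) - b (k + 2) * b' (k + 1))) • P k := by
  -- Addition in `Fin 3` wraps around, so `k, k + 1, k + 2` is always a cyclic permutation of the
  -- three units.
  have e1 : (1 : Fin 3) + 2 = 0 := rfl
  have e2 : (2 : Fin 3) + 2 = 1 := rfl
  have e3 : (2 : Fin 3) + 1 = 0 := rfl
  have e4 : (1 : Fin 3) + 1 = 2 := rfl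
  simp only [Fin.sum_univ_three, Matrix.mul_add, Matrix.add_mul, Matrix.mul_smul,
    Matrix.smul_mul, hJ.sq, hJ.mul_eq, hJ.anticomm, hJ.zero_mul_two, hJ.two_mul_zero,
    hJ.one_mul_two, hJ.two_mul_one, hP.sq, hP.mul_eq, hP.anticomm, hP.zero_mul_two,
    hP.two_mul_zero, hP.one_mul_two, hP.two_mul_one, hJP, Matrix.mul_one, Matrix.one_mul,
    e1, e2, e3, e4, zero_add]
  module

end CoordGeom
end

noncomputable section

namespace UH

open CoordGeom

/-! ### The moving frame of the one-loop deformed universal hypermultiplet -/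

/-- The points at which all coefficients of `gUH c` are smooth and nonzero and `ρ + c` is
positive. -/
def regularSet (c : ℝ) : Set (Fin 4 → ℝ) := {x | x 0 ≠ 0 ∧ 0 < x 0 + c ∧ x 0 + 2 * c ≠ 0}

lemma isOpen_regularSet (c : ℝ) : IsOpen (regularSet c) := by
  have h1 : IsOpen {x : Fin 4 → ℝ | x 0 ≠ 0} := isOpen_ne_fun (by fun_prop) (by fun_prop)
  have h2 : IsOpen {x : Fin 4 → ℝ | 0 < x 0 + c} := isOpen_lt (by fun_prop) (by fun_prop)
  have h3 : IsOpen {x : Fin 4 → ℝ | x 0 + 2 * c ≠ 0} := isOpen_ne_fun (by fun_prop) (by fun_prop)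
  exact h1.inter (h2.inter h3)

/-- The conformal factor `(ρ + 2c) / (4 ρ² (ρ + c))`. -/
def conf (c r : ℝ) : ℝ := (r + 2 * c) / (4 * r ^ 2 * (r + c))

/-- The coefficient of `dφ + ζ dζ̃ - ζ̃ dζ` in the coframe. -/
def pCoef (c r : ℝ) : ℝ := (r + c) / (r + 2 * c)

/-- The coefficient of `dζ̃` and `dζ` in the coframe. -/
def sCoef (c r : ℝ) : ℝ := √(2 * (r + c))

/-- Half the logarithmic derivative of the conformal factor. -/
def logConf (c r : ℝ) : ℝ := (1 / (r + 2 * c) - 1 / (r + c)) / 2 - 1 / r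

/-- The coframe `(dρ, p η, s dζ̃, s dζ)`. -/
def coframe (c : ℝ) (x : Fin 4 → ℝ) : Matrix (Fin 4) (Fin 4) ℝ :=
  !![1, 0, 0, 0;
     0, pCoef c (x 0), pCoef c (x 0) * x 3, pCoef c (x 0) * -x 2;
     0, 0, sCoef c (x 0), 0;
     0, 0, 0, sCoef c (x 0)]

/-- The frame dual to `coframe`. -/
def frame (c : ℝ) (x : Fin 4 → ℝ) : Matrix (Fin 4) (Fin 4) ℝ :=
  !![1, 0, 0, 0;
     0, (pCoef c (x 0))⁻¹, (sCoef c (x 0))⁻¹ * -x 3, (sCoef c (x 0))⁻¹ * x 2;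
     0, 0, (sCoef c (x 0))⁻¹, 0;
     0, 0, 0, (sCoef c (x 0))⁻¹]

/-- The basic one-forms `η, dζ̃, dζ`. -/
def basicForm (k : Fin 3) (x : Fin 4 → ℝ) : Fin 4 → ℝ :=
  ![etaUH x, Pi.single 2 1, Pi.single 3 1] k

/-- The quaternion units spanning the quaternionic structure in the coframe. -/
def unitQ : Fin 3 → Matrix (Fin 4) (Fin 4) ℝ :=
  ![!![0, -1, 0, 0; 1, 0, 0, 0; 0, 0, 0, 1; 0, 0, -1, 0],
    !![0, 0, -1, 0; 0, 0, 0, -1; 1, 0, 0, 0; 0, 1, 0, 0],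
    !![0, 0, 0, 1; 0, 0, -1, 0; 0, 1, 0, 0; -1, 0, 0, 0]]

/-- The quaternion units commuting with `unitQ`. -/
def unitC : Fin 3 → Matrix (Fin 4) (Fin 4) ℝ :=
  ![!![0, -1, 0, 0; 1, 0, 0, 0; 0, 0, 0, -1; 0, 0, 1, 0],
    !![0, 0, -1, 0; 0, 0, 0, 1; 1, 0, 0, 0; 0, -1, 0, 0],
    !![0, 0, 0, -1; 0, 0, -1, 0; 0, 1, 0, 0; 1, 0, 0, 0]]

/-- The coefficients of the `unitQ`-part of the connection form. -/
def coefQ (c : ℝ) (k : Fin 3) (r : ℝ) : ℝ :=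
  ![-1 / (4 * r), -sCoef c r / (2 * r), sCoef c r / (2 * r)] k

/-- The coefficients of the `unitC`-part of the connection form. -/
def coefC (c : ℝ) (k : Fin 3) (r : ℝ) : ℝ :=
  ![-(r ^ 2 + 2 * (r + c) * (r + 2 * c)) / (4 * r * (r + 2 * c) ^ 2),
    -c * sCoef c r / (r * (r + 2 * c)), -c * sCoef c r / (r * (r + 2 * c))] k

/-- The connection form of the metric in the coframe. -/
def connForm (c : ℝ) (i : Fin 4) (x : Fin 4 → ℝ) : Matrix (Fin 4) (Fin 4) ℝ :=
  (logConf c (x 0) * (Pi.single 0 1 : Fin 4 → ℝ) i) • 1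
    + ∑ k, (coefQ c k (x 0) * basicForm k x i) • unitQ k
    + ∑ k, (coefC c k (x 0) * basicForm k x i) • unitC k

lemma unitQ_triple : IsQuaternionTriple unitQ := by
  constructor <;> ext i j <;> fin_cases i <;> fin_cases j <;>
    simp [unitQ, Matrix.mul_apply, Fin.sum_univ_four]

lemma unitC_triple : IsQuaternionTriple unitC := by
  constructor <;> ext i j <;> fin_cases i <;> fin_cases j <;>
    simp [unitC, Matrix.mul_apply, Fin.sum_univ_four]

lemma unitQ_commute (k l : Fin 3) : unitQ k * unitC l = unitC l * unitQ k := by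
  ext i j
  fin_cases k <;> fin_cases l <;> fin_cases i <;> fin_cases j <;>
    simp [unitQ, unitC, Matrix.mul_apply, Fin.sum_univ_four]

lemma unitQ_skew (k : Fin 3) : (unitQ k)ᵀ = -unitQ k := by
  ext i j
  fin_cases k <;> fin_cases i <;> fin_cases j <;> simp [unitQ]

lemma unitC_skew (k : Fin 3) : (unitC k)ᵀ = -unitC k := by
  ext i j
  fin_cases k <;> fin_cases i <;> fin_cases j <;> simp [unitC]

lemma sCoef_pos {c r : ℝ} (h : 0 < r + c) : 0 < sCoef c r := Real.sqrt_pos.2 (by linarith)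

lemma sCoef_sq {c r : ℝ} (h : 0 < r + c) : sCoef c r ^ 2 = 2 * (r + c) :=
  Real.sq_sqrt (by linarith)

lemma coframe_mul_frame {c : ℝ} {x : Fin 4 → ℝ} (hx : x ∈ regularSet c) :
    coframe c x * frame c x = 1 := by
  have hs := (sCoef_pos hx.2.1).ne'
  have hp : pCoef c (x 0) ≠ 0 := div_ne_zero hx.2.1.ne' hx.2.2
  ext i j
  fin_cases i <;> fin_cases j <;>
    simp [coframe, frame, Matrix.mul_apply, Fin.sum_univ_four, hs, hp] <;> field_simp <;> ring

/-- Taking out the conformal factor avoids the square root of `ρ + 2c`, whose sign differs between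
the domains; that sign now sits in `conf` alone. -/
lemma gUH_eq {c : ℝ} {x : Fin 4 → ℝ} (hx : x ∈ regularSet c) :
    gUH c x = conf c (x 0) • ((coframe c x)ᵀ * coframe c x) := by
  obtain ⟨h1, h2, h3⟩ := hx
  have hs := sCoef_sq h2
  have hs0 := (sCoef_pos h2).ne'
  generalize hr : x 0 = r at *
  ext i j
  have e : ((coframe c x)ᵀ * coframe c x) i j =
      (Matrix.vecMulVec (Pi.single 0 1) (Pi.single 0 1)
      + pCoef c r ^ 2 • Matrix.vecMulVec (etaUH x) (etaUH x)
      + (2 * (r + c)) • (Matrix.vecMulVec (Pi.single 2 1) (Pi.single 2 1)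
          + Matrix.vecMulVec (Pi.single 3 1) (Pi.single 3 1)) :
        Matrix (Fin 4) (Fin 4) ℝ) i j := by
    rw [← hs]
    fin_cases i <;> fin_cases j <;>
      simp [coframe, etaUH, Matrix.mul_apply, Fin.sum_univ_four, Matrix.vecMulVec_apply, hr] <;>
      ring
  have h2' := h2.ne'
  rw [Matrix.smul_apply, e, gUH, hr]
  simp only [Matrix.add_apply, Matrix.smul_apply, smul_eq_mul, conf, pCoef]
  field_simp

end UH
end

noncomputable section

namespace UH

open CoordGeom

/-! ### Derivatives of the coefficients -/

lemma contDiffOn_radial {f : ℝ → ℝ} {U : Set (Fin 4 → ℝ)} (h : ∀ x ∈ U, ContDiffAt ℝ ∞ f (x 0)) :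
    ContDiffOn ℝ ∞ (fun x => f (x 0)) U := fun x hx =>
  ((h x hx).comp x (contDiff_apply ℝ ℝ (0 : Fin 4)).contDiffAt).contDiffWithinAt

lemma pderiv_radial_mul {f : ℝ → ℝ} {f' : ℝ} {l : (Fin 4 → ℝ) → ℝ} {x : Fin 4 → ℝ}
    (hf : HasDerivAt f f' (x 0)) (hl : DifferentiableAt ℝ l x) (i : Fin 4) :
    pderiv i (fun y => f (y 0) * l y) x =
      f' * (Pi.single 0 1 : Fin 4 → ℝ) i * l x + f (x 0) * pderiv i l x := by
  have h0 : HasFDerivAt (fun y : Fin 4 → ℝ => y 0) (ContinuousLinearMap.proj 0) x :=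
    hasFDerivAt_apply (𝕜 := ℝ) 0 x
  have h1 : HasFDerivAt (fun y => f (y 0) * l y) _ x :=
    (hf.comp_hasFDerivAt x h0).mul hl.hasFDerivAt
  have h2 : (Pi.single i 1 : Fin 4 → ℝ) 0 = (Pi.single 0 1 : Fin 4 → ℝ) i := by
    simp only [Pi.single_apply, eq_comm]
  unfold pderiv
  rw [h1.fderiv]
  simp [h2]
  ring

lemma pderiv_const (a : ℝ) (i : Fin 4) (x : Fin 4 → ℝ) : pderiv i (fun _ => a) x = 0 := by
  simp [pderiv]

lemma pderiv_coord (i j : Fin 4) (x : Fin 4 → ℝ) :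
    pderiv i (fun y => y j) x = (Pi.single i 1 : Fin 4 → ℝ) j := by
  have h0 : HasFDerivAt (fun y : Fin 4 → ℝ => y j) (ContinuousLinearMap.proj j) x :=
    hasFDerivAt_apply (𝕜 := ℝ) j x
  rw [pderiv, h0.fderiv]
  rfl

lemma pderiv_neg_coord (i j : Fin 4) (x : Fin 4 → ℝ) :
    pderiv i (fun y => -y j) x = -(Pi.single i 1 : Fin 4 → ℝ) j := by
  have h0 : HasFDerivAt (fun y : Fin 4 → ℝ => -y j) (-ContinuousLinearMap.proj j) x :=
    HasFDerivAt.fun_neg (hasFDerivAt_apply (𝕜 := ℝ) j x)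
  rw [pderiv, h0.fderiv]
  rfl

lemma pderiv_radial {f : ℝ → ℝ} {f' : ℝ} {x : Fin 4 → ℝ} (hf : HasDerivAt f f' (x 0))
    (i : Fin 4) : pderiv i (fun y => f (y 0)) x = f' * (Pi.single 0 1 : Fin 4 → ℝ) i := by
  simpa [pderiv_const] using pderiv_radial_mul hf (differentiableAt_const (1 : ℝ)) i

section coefficients

variable {c r : ℝ}

lemma hasDerivAt_sCoef (h2 : 0 < r + c) : HasDerivAt (sCoef c) (sCoef c r)⁻¹ r := by
  have h := (((hasDerivAt_id r).add_const c).const_mul 2).sqrt (by simp; linarith)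
  refine h.congr_deriv ?_
  have := (sCoef_pos h2).ne'
  change 2 * 1 / (2 * sCoef c r) = _
  field_simp

lemma hasDerivAt_pCoef (h3 : r + 2 * c ≠ 0) :
    HasDerivAt (pCoef c) (c / (r + 2 * c) ^ 2) r := by
  have h := ((hasDerivAt_id r).add_const c).div ((hasDerivAt_id r).add_const (2 * c)) h3
  refine h.congr_deriv ?_
  simp
  ring

lemma hasDerivAt_conf (h1 : r ≠ 0) (h2 : 0 < r + c) (h3 : r + 2 * c ≠ 0) :
    HasDerivAt (conf c) (conf c r * (2 * logConf c r)) r := by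
  have h := ((hasDerivAt_id r).add_const (2 * c)).div
    ((((hasDerivAt_id r).pow 2).const_mul 4).mul ((hasDerivAt_id r).add_const c))
    (mul_ne_zero (mul_ne_zero four_ne_zero (pow_ne_zero 2 h1)) h2.ne')
  refine h.congr_deriv ?_
  have h2' := h2.ne'
  have h3' : r + c * 2 ≠ 0 := by rwa [mul_comm c]
  simp [conf, logConf]
  field_simp
  ring

lemma contDiffAt_sCoef (h2 : 0 < r + c) : ContDiffAt ℝ ∞ (sCoef c) r := by
  unfold sCoef
  exact ContDiffAt.sqrt (by fun_prop) (by linarith)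

lemma contDiffAt_pCoef (h3 : r + 2 * c ≠ 0) : ContDiffAt ℝ ∞ (pCoef c) r := by
  unfold pCoef
  exact ContDiffAt.div (by fun_prop) (by fun_prop) h3

lemma contDiffAt_conf (h1 : r ≠ 0) (h2 : 0 < r + c) : ContDiffAt ℝ ∞ (conf c) r := by
  unfold conf
  exact ContDiffAt.div (by fun_prop) (by fun_prop)
    (mul_ne_zero (mul_ne_zero four_ne_zero (pow_ne_zero 2 h1)) h2.ne')

lemma contDiffAt_logConf (h1 : r ≠ 0) (h2 : 0 < r + c) (h3 : r + 2 * c ≠ 0) :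
    ContDiffAt ℝ ∞ (logConf c) r := by
  unfold logConf
  have h2' := h2.ne'
  fun_prop (disch := assumption)

lemma contDiffAt_coefQ (h1 : r ≠ 0) (h2 : 0 < r + c) (k : Fin 3) :
    ContDiffAt ℝ ∞ (coefQ c k) r := by
  have hs := contDiffAt_sCoef h2
  have h : (2 * r) ≠ 0 := mul_ne_zero two_ne_zero h1
  have h' : (4 * r) ≠ 0 := mul_ne_zero four_ne_zero h1
  unfold coefQ
  fin_cases k <;> simp only [Fin.zero_eta, Fin.mk_one, Fin.reduceFinMk, Matrix.cons_val]
  · exact ContDiffAt.div (by fun_prop) (by fun_prop) h'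
  · exact ContDiffAt.div hs.neg (by fun_prop) h
  · exact ContDiffAt.div hs (by fun_prop) h

lemma contDiffAt_coefC (h1 : r ≠ 0) (h2 : 0 < r + c) (h3 : r + 2 * c ≠ 0) (k : Fin 3) :
    ContDiffAt ℝ ∞ (coefC c k) r := by
  have hs := contDiffAt_sCoef h2
  have h : r * (r + 2 * c) ≠ 0 := mul_ne_zero h1 h3
  have h' : 4 * r * (r + 2 * c) ^ 2 ≠ 0 :=
    mul_ne_zero (mul_ne_zero four_ne_zero h1) (pow_ne_zero 2 h3)
  unfold coefC
  fin_cases k <;> simp only [Fin.zero_eta, Fin.mk_one, Fin.reduceFinMk, Matrix.cons_val]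
  · exact ContDiffAt.div (by fun_prop) (by fun_prop) h'
  · exact ContDiffAt.div (contDiffAt_const.mul hs) (by fun_prop) h
  · exact ContDiffAt.div (contDiffAt_const.mul hs) (by fun_prop) h

/-- The derivatives of `coefQ`. -/
def coefQ' (c : ℝ) (k : Fin 3) (r : ℝ) : ℝ :=
  ![1 / (4 * r ^ 2), -((sCoef c r)⁻¹ / (2 * r) - sCoef c r / (2 * r ^ 2)),
    (sCoef c r)⁻¹ / (2 * r) - sCoef c r / (2 * r ^ 2)] k

/-- The derivatives of `coefC`. -/
def coefC' (c : ℝ) (k : Fin 3) (r : ℝ) : ℝ :=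
  ![-((4 * r + 2 * r + 6 * c - (r ^ 2 + 2 * (r + c) * (r + 2 * c)) * (1 / r + 2 / (r + 2 * c)))
      / (4 * r * (r + 2 * c) ^ 2)) ,
    -c * ((sCoef c r)⁻¹ - sCoef c r * (1 / r + 1 / (r + 2 * c))) / (r * (r + 2 * c)),
    -c * ((sCoef c r)⁻¹ - sCoef c r * (1 / r + 1 / (r + 2 * c))) / (r * (r + 2 * c))] k

lemma hasDerivAt_coefQ (h1 : r ≠ 0) (h2 : 0 < r + c) (k : Fin 3) :
    HasDerivAt (coefQ c k) (coefQ' c k r) r := by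
  have hs := hasDerivAt_sCoef h2
  have h : (2 * r) ≠ 0 := mul_ne_zero two_ne_zero h1
  have h' : (4 * r) ≠ 0 := mul_ne_zero four_ne_zero h1
  have hs0 := (sCoef_pos h2).ne'
  unfold coefQ coefQ'
  fin_cases k <;> simp only [Fin.zero_eta, Fin.mk_one, Fin.reduceFinMk, Matrix.cons_val]
  · refine ((hasDerivAt_const r (-1 : ℝ)).div ((hasDerivAt_id r).const_mul 4) h').congr_deriv ?_
    simp
    field_simp
  · refine (hs.neg.div ((hasDerivAt_id r).const_mul 2) h).congr_deriv ?_
    simp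
    field_simp
    ring
  · refine (hs.div ((hasDerivAt_id r).const_mul 2) h).congr_deriv ?_
    simp
    field_simp

lemma hasDerivAt_coefC (h1 : r ≠ 0) (h2 : 0 < r + c) (h3 : r + 2 * c ≠ 0) (k : Fin 3) :
    HasDerivAt (coefC c k) (coefC' c k r) r := by
  have hs := hasDerivAt_sCoef h2
  have hs0 := (sCoef_pos h2).ne'
  have h : r * (r + 2 * c) ≠ 0 := mul_ne_zero h1 h3
  have h' : 4 * r * (r + 2 * c) ^ 2 ≠ 0 :=
    mul_ne_zero (mul_ne_zero four_ne_zero h1) (pow_ne_zero 2 h3)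
  have h3' : r + c * 2 ≠ 0 := by rwa [mul_comm c]
  have hB := (hasDerivAt_id r).add_const (2 * c)
  have hrB := (hasDerivAt_id r).mul hB
  have hsB := (hs.const_mul (-c)).div hrB h
  have hsB' : -c * ((sCoef c r)⁻¹ - sCoef c r * (1 / r + 1 / (r + 2 * c))) / (r * (r + 2 * c)) =
      (-c * (sCoef c r)⁻¹ * (r * (r + 2 * c)) - -c * sCoef c r * (1 * (r + 2 * c) + r * 1)) /
        (r * (r + 2 * c)) ^ 2 := by
    field_simp
    ring
  unfold coefC coefC'
  fin_cases k <;> simp only [Fin.zero_eta, Fin.mk_one, Fin.reduceFinMk, Matrix.cons_val]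
  · have hA := ((hasDerivAt_id r).add_const c).const_mul 2
    have h4 := (((hasDerivAt_id r).pow 2).add (hA.mul hB)).neg.div
      (((hasDerivAt_id r).const_mul 4).mul (hB.pow 2)) h'
    refine h4.congr_deriv ?_
    simp
    field_simp
    ring
  · rw [hsB']
    exact hsB
  · rw [hsB']
    exact hsB

end coefficients

end UH
end

noncomputable section

namespace UH

open CoordGeom

/-! ### The connection form -/

variable {c : ℝ} {x : Fin 4 → ℝ}

lemma smoothOn_coframe (c : ℝ) : SmoothOn (coframe c) (regularSet c) := by
  have hp : ContDiffOn ℝ ∞ (fun x => pCoef c (x 0)) (regularSet c) :=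
    contDiffOn_radial fun x hx => contDiffAt_pCoef hx.2.2
  have hs : ContDiffOn ℝ ∞ (fun x => sCoef c (x 0)) (regularSet c) :=
    contDiffOn_radial fun x hx => contDiffAt_sCoef hx.2.1
  intro i j
  fin_cases i <;> fin_cases j <;> first
    | exact contDiffOn_const
    | exact hp
    | exact hs
    | exact hp.mul (by fun_prop)

lemma smoothOn_frame (c : ℝ) : SmoothOn (frame c) (regularSet c) := by
  have hp : ContDiffOn ℝ ∞ (fun x => (pCoef c (x 0))⁻¹) (regularSet c) :=
    contDiffOn_radial fun x hx => (contDiffAt_pCoef hx.2.2).inv (div_ne_zero hx.2.1.ne' hx.2.2)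
  have hs : ContDiffOn ℝ ∞ (fun x => (sCoef c (x 0))⁻¹) (regularSet c) :=
    contDiffOn_radial fun x hx => (contDiffAt_sCoef hx.2.1).inv (sCoef_pos hx.2.1).ne'
  intro i j
  fin_cases i <;> fin_cases j <;> first
    | exact contDiffOn_const
    | exact hp
    | exact hs
    | exact hs.mul (by fun_prop)

lemma contDiff_basicForm (k : Fin 3) (i : Fin 4) : ContDiff ℝ ∞ fun x => basicForm k x i := by
  fin_cases k <;> fin_cases i <;> simp [basicForm, etaUH] <;> fun_prop

lemma contDiffOn_coefQ (c : ℝ) (k : Fin 3) (i : Fin 4) :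
    ContDiffOn ℝ ∞ (fun x => coefQ c k (x 0) * basicForm k x i) (regularSet c) :=
  (contDiffOn_radial fun _ hx => contDiffAt_coefQ hx.1 hx.2.1 k).mul
    (contDiff_basicForm k i).contDiffOn

lemma contDiffOn_coefC (c : ℝ) (k : Fin 3) (i : Fin 4) :
    ContDiffOn ℝ ∞ (fun x => coefC c k (x 0) * basicForm k x i) (regularSet c) :=
  (contDiffOn_radial fun _ hx => contDiffAt_coefC hx.1 hx.2.1 hx.2.2 k).mul
    (contDiff_basicForm k i).contDiffOn

lemma contDiffOn_logConf (c : ℝ) (i : Fin 4) :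
    ContDiffOn ℝ ∞ (fun x => logConf c (x 0) * (Pi.single 0 1 : Fin 4 → ℝ) i) (regularSet c) :=
  (contDiffOn_radial fun _ hx => contDiffAt_logConf hx.1 hx.2.1 hx.2.2).mul contDiffOn_const

lemma smoothOn_sum_smul {f : Fin 3 → (Fin 4 → ℝ) → ℝ} {U : Set (Fin 4 → ℝ)}
    (hf : ∀ k, ContDiffOn ℝ ∞ (f k) U) (A : Fin 3 → Matrix (Fin 4) (Fin 4) ℝ) :
    SmoothOn (fun x => ∑ k, f k x • A k) U := by
  intro i j
  simp only [Matrix.sum_apply, Matrix.smul_apply, smul_eq_mul]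
  exact ContDiffOn.sum fun k _ => (hf k).mul contDiffOn_const

lemma matPderiv_sum_smul {f : Fin 3 → (Fin 4 → ℝ) → ℝ} {U : Set (Fin 4 → ℝ)} (hU : IsOpen U)
    (hf : ∀ k, ContDiffOn ℝ ∞ (f k) U) (A : Fin 3 → Matrix (Fin 4) (Fin 4) ℝ) (i : Fin 4)
    (hx : x ∈ U) :
    matPderiv i (fun x => ∑ k, f k x • A k) x = ∑ k, pderiv i (f k) x • A k := by
  have hd : ∀ k, DifferentiableAt ℝ (f k) x := fun k =>
    ((hf k).contDiffAt (hU.mem_nhds hx)).differentiableAt (by simp)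
  have hs : ∀ k, SmoothOn (fun x => f k x • A k) U := fun k => SmoothOn.smul (hf k) (smoothOn_const (A k) U)
  have h1 : ∀ k, matPderiv i (fun x => f k x • A k) x = pderiv i (f k) x • A k := by
    intro k
    rw [matPderiv_smul (A := fun _ => A k) (hd k) (fun _ _ => differentiableAt_const _),
      matPderiv_const, smul_zero,
      add_zero]
  simp only [Fin.sum_univ_three]
  rw [matPderiv_add hU ((hs 0).add (hs 1)) (hs 2) i hx, matPderiv_add hU (hs 0) (hs 1) i hx,
    h1, h1, h1]

lemma smoothOn_connForm (c : ℝ) (i : Fin 4) : SmoothOn (connForm c i) (regularSet c) :=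
  ((SmoothOn.smul (contDiffOn_logConf c i) (smoothOn_const 1 _)).add
    (smoothOn_sum_smul (fun k => contDiffOn_coefQ c k i) unitQ)).add
    (smoothOn_sum_smul (fun k => contDiffOn_coefC c k i) unitC)

/-- The derivative of the coframe in the direction `∂_i`. -/
def dCoframe (c : ℝ) (x : Fin 4 → ℝ) (i : Fin 4) : Matrix (Fin 4) (Fin 4) ℝ :=
  ![!![0, 0, 0, 0;
       0, c / (x 0 + 2 * c) ^ 2, c / (x 0 + 2 * c) ^ 2 * x 3, c / (x 0 + 2 * c) ^ 2 * -x 2;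
       0, 0, (sCoef c (x 0))⁻¹, 0;
       0, 0, 0, (sCoef c (x 0))⁻¹],
    0,
    !![0, 0, 0, 0; 0, 0, 0, -pCoef c (x 0); 0, 0, 0, 0; 0, 0, 0, 0],
    !![0, 0, 0, 0; 0, 0, pCoef c (x 0), 0; 0, 0, 0, 0; 0, 0, 0, 0]] i

lemma matPderiv_coframe (hx : x ∈ regularSet c) (i : Fin 4) :
    matPderiv i (coframe c) x = dCoframe c x i := by
  have hp := hasDerivAt_pCoef hx.2.2
  have hs := hasDerivAt_sCoef hx.2.1
  have h1 := pderiv_radial hp i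
  have h2 := pderiv_radial hs i
  have h3 := pderiv_radial_mul hp (l := fun y => y 3) (by fun_prop) i
  have h4 := pderiv_radial_mul hp (l := fun y => -y 2) (by fun_prop) i
  rw [pderiv_coord] at h3
  rw [pderiv_neg_coord] at h4
  ext k j
  fin_cases k <;> fin_cases j <;>
    simp [matPderiv, coframe, pderiv_const, h1, h2, h3, h4, -mul_neg] <;>
    fin_cases i <;> simp [dCoframe]

lemma connForm_add_transpose (i : Fin 4) (x : Fin 4 → ℝ) :
    connForm c i x + (connForm c i x)ᵀ =
      (2 * logConf c (x 0) * (Pi.single 0 1 : Fin 4 → ℝ) i) • 1 := by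
  simp only [connForm, Fin.sum_univ_three, Matrix.transpose_add, Matrix.transpose_smul,
    unitQ_skew, unitC_skew, Matrix.transpose_one]
  module

lemma connForm_eq (i : Fin 4) (x : Fin 4 → ℝ) : connForm c i x =
    !![logConf c (x 0) * (Pi.single 0 1 : Fin 4 → ℝ) i,
        -((coefQ c 0 (x 0) + coefC c 0 (x 0)) * basicForm 0 x i),
        -((coefQ c 1 (x 0) + coefC c 1 (x 0)) * basicForm 1 x i),
        -((coefC c 2 (x 0) - coefQ c 2 (x 0)) * basicForm 2 x i);
      (coefQ c 0 (x 0) + coefC c 0 (x 0)) * basicForm 0 x i,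
        logConf c (x 0) * (Pi.single 0 1 : Fin 4 → ℝ) i,
        -((coefC c 2 (x 0) + coefQ c 2 (x 0)) * basicForm 2 x i),
        (coefC c 1 (x 0) - coefQ c 1 (x 0)) * basicForm 1 x i;
      (coefQ c 1 (x 0) + coefC c 1 (x 0)) * basicForm 1 x i,
        (coefC c 2 (x 0) + coefQ c 2 (x 0)) * basicForm 2 x i,
        logConf c (x 0) * (Pi.single 0 1 : Fin 4 → ℝ) i,
        (coefQ c 0 (x 0) - coefC c 0 (x 0)) * basicForm 0 x i;
      (coefC c 2 (x 0) - coefQ c 2 (x 0)) * basicForm 2 x i,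
        -((coefC c 1 (x 0) - coefQ c 1 (x 0)) * basicForm 1 x i),
        -((coefQ c 0 (x 0) - coefC c 0 (x 0)) * basicForm 0 x i),
        logConf c (x 0) * (Pi.single 0 1 : Fin 4 → ℝ) i] := by
  ext k l
  fin_cases k <;> fin_cases l <;> simp [connForm, Fin.sum_univ_three, unitQ, unitC] <;> ring

/-- Entries are expressed through `dρ, η, dζ̃, dζ`. The structure equations then become identities
between coefficients of wedge products, valid for arbitrary vectors in place of these one-forms. -/
lemma coframe_eq (x : Fin 4 → ℝ) (k j : Fin 4) : coframe c x k j =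
    ![(Pi.single 0 1 : Fin 4 → ℝ) j, pCoef c (x 0) * basicForm 0 x j,
      sCoef c (x 0) * basicForm 1 x j, sCoef c (x 0) * basicForm 2 x j] k := by
  fin_cases k <;> fin_cases j <;> simp [coframe, basicForm, etaUH]

lemma dCoframe_eq (x : Fin 4 → ℝ) (i k j : Fin 4) : dCoframe c x i k j =
    ![0, c / (x 0 + 2 * c) ^ 2 * (Pi.single 0 1 : Fin 4 → ℝ) i * basicForm 0 x j
        + pCoef c (x 0) * (basicForm 2 x i * basicForm 1 x j - basicForm 1 x i * basicForm 2 x j),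
      (sCoef c (x 0))⁻¹ * (Pi.single 0 1 : Fin 4 → ℝ) i * basicForm 1 x j,
      (sCoef c (x 0))⁻¹ * (Pi.single 0 1 : Fin 4 → ℝ) i * basicForm 2 x j] k := by
  fin_cases i <;> fin_cases k <;> fin_cases j <;> simp [dCoframe, basicForm, etaUH]

/-- The first structure equation, compared coefficient by coefficient: `t1`–`t3` are the terms with
`dρ`, `t4` and `t5` the term `dζ̃ ∧ dζ` produced by `dη`, `t6` and `t7` the terms `η ∧ dζ` and `η ∧
dζ̃`. The `dρ` row holds by skewness alone. -/
lemma connForm_torsion (hx : x ∈ regularSet c) (i j k : Fin 4) :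
    (connForm c i x * coframe c x + dCoframe c x i) k j =
      (connForm c j x * coframe c x + dCoframe c x j) k i := by
  obtain ⟨h1, h2, h3⟩ := hx
  have hs := sCoef_sq h2
  have hs0 := (sCoef_pos h2).ne'
  have h2' := h2.ne'
  have h3' : x 0 + c * 2 ≠ 0 := by rwa [mul_comm c]
  have t1 : coefQ c 0 (x 0) + coefC c 0 (x 0) =
      logConf c (x 0) * pCoef c (x 0) + c / (x 0 + 2 * c) ^ 2 := by
    simp only [coefQ, coefC, logConf, pCoef, Matrix.cons_val]
    field_simp
    ring
  have t2 : coefQ c 1 (x 0) + coefC c 1 (x 0) =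
      logConf c (x 0) * sCoef c (x 0) + (sCoef c (x 0))⁻¹ := by
    simp only [coefQ, coefC, logConf, Matrix.cons_val]
    field_simp
    rw [hs]
    ring
  have t3 : coefC c 2 (x 0) - coefQ c 2 (x 0) =
      logConf c (x 0) * sCoef c (x 0) + (sCoef c (x 0))⁻¹ := by
    simp only [coefQ, coefC, logConf, Matrix.cons_val]
    field_simp
    rw [hs]
    ring
  have t4 : (coefC c 1 (x 0) - coefQ c 1 (x 0)) * sCoef c (x 0) = pCoef c (x 0) := by
    simp only [coefQ, coefC, pCoef, Matrix.cons_val]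
    field_simp
    rw [hs]
    ring
  have t5 : (coefC c 2 (x 0) + coefQ c 2 (x 0)) * sCoef c (x 0) = pCoef c (x 0) := by
    simp only [coefQ, coefC, pCoef, Matrix.cons_val]
    field_simp
    rw [hs]
    ring
  have t6 : (coefQ c 0 (x 0) - coefC c 0 (x 0)) * sCoef c (x 0) =
      (coefC c 2 (x 0) + coefQ c 2 (x 0)) * pCoef c (x 0) := by
    simp only [coefQ, coefC, pCoef, Matrix.cons_val]
    field_simp
    ring
  have t7 : (coefQ c 0 (x 0) - coefC c 0 (x 0)) * sCoef c (x 0) =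
      (coefC c 1 (x 0) - coefQ c 1 (x 0)) * pCoef c (x 0) := by
    simp only [coefQ, coefC, pCoef, Matrix.cons_val]
    field_simp
    ring
  have hmul : ∀ i : Fin 4, (connForm c i x * coframe c x + dCoframe c x i) k =
      fun j => ∑ l, connForm c i x k l * coframe c x l j + dCoframe c x i k j := fun i => rfl
  rw [hmul, hmul]
  simp only [Fin.sum_univ_four, connForm_eq, coframe_eq, dCoframe_eq]
  generalize (Pi.single 0 1 : Fin 4 → ℝ) = e, basicForm 0 x = η, basicForm 1 x = X,
    basicForm 2 x = Y
  fin_cases k <;> simp only [Fin.zero_eta, Fin.mk_one, Fin.reduceFinMk, Matrix.cons_val,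
    Matrix.of_apply]
  · ring
  · linear_combination (η i * e j - η j * e i) * t1 + (X i * Y j - X j * Y i) * (t4 + t5)
  · linear_combination (X i * e j - X j * e i) * t2 + (η i * Y j - η j * Y i) * t6
  · linear_combination (Y i * e j - Y j * e i) * t3 - (η i * X j - η j * X i) * t7

lemma isConnectionFormOn {σ : ℝ} (hσ : σ ≠ 0) (c : ℝ) :
    IsConnectionFormOn (σ • gUH c) (regularSet c) (coframe c) (frame c) (connForm c) := by
  have hconf : ∀ x ∈ regularSet c, HasDerivAt (fun r => σ * conf c r)
      (σ * (conf c (x 0) * (2 * logConf c (x 0)))) (x 0) := fun x hx =>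
    (hasDerivAt_conf hx.1 hx.2.1 hx.2.2).const_mul σ
  refine isConnectionFormOn_of_conformal (f := fun x => σ * conf c (x 0))
    (θ := fun i x => 2 * logConf c (x 0) * (Pi.single 0 1 : Fin 4 → ℝ) i)
    (isOpen_regularSet c) (smoothOn_coframe c) (smoothOn_frame c) (smoothOn_connForm c)
    (contDiffOn_const.mul (contDiffOn_radial fun x hx => contDiffAt_conf hx.1 hx.2.1)) ?_ ?_
    (fun x hx => coframe_mul_frame hx) ?_ (fun i x _ => connForm_add_transpose i x) ?_
  · intro x hx
    exact mul_ne_zero hσ (div_ne_zero hx.2.2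
      (mul_ne_zero (mul_ne_zero four_ne_zero (pow_ne_zero 2 hx.1)) hx.2.1.ne'))
  · intro x hx
    rw [Pi.smul_apply, gUH_eq hx, smul_smul]
  · intro i x hx
    rw [pderiv_radial (hconf x hx) i]
    ring
  · intro x hx i j k
    rw [matPderiv_coframe hx, matPderiv_coframe hx]
    exact connForm_torsion hx i j k

end UH
end

noncomputable section

namespace UH

open CoordGeom

/-! ### The curvature -/

variable {c : ℝ} {x : Fin 4 → ℝ}

/-- The eigenvalues of the curvature on the `unitC`-part. -/
def curvC (c : ℝ) (k : Fin 3) (r : ℝ) : ℝ :=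
  ![-(1 + 2 * r ^ 3 / (r + 2 * c) ^ 3), -(1 - r ^ 3 / (r + 2 * c) ^ 3),
    -(1 - r ^ 3 / (r + 2 * c) ^ 3)] k

lemma pderiv_basicForm (x : Fin 4 → ℝ) (k : Fin 3) (i j : Fin 4) :
    pderiv i (fun y => basicForm k y j) x =
      ![basicForm 2 x i * basicForm 1 x j - basicForm 1 x i * basicForm 2 x j, 0, 0] k := by
  fin_cases k <;> fin_cases j <;>
    simp [basicForm, etaUH, pderiv_const, pderiv_coord, pderiv_neg_coord] <;>
    fin_cases i <;> simp

lemma differentiableAt_basicForm (x : Fin 4 → ℝ) (k : Fin 3) (j : Fin 4) :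
    DifferentiableAt ℝ (fun y => basicForm k y j) x :=
  ((contDiff_basicForm k j).differentiable (by simp)).differentiableAt

/-- The heart of the quaternionic Kähler property: the `sp(1)`-curvature `dα_k + 2 α_{k+1} ∧
α_{k+2}` is proportional to the fundamental two-form of the same unit, with a factor independent of
`k`. Each two-form has two wedge terms, hence the pairs `t1, t2`, `t3, t4` and `t5, t6`. -/
lemma structure_coefQ (hx : x ∈ regularSet c) (k : Fin 3) (i j : Fin 4) :
    pderiv i (fun y => coefQ c k (y 0) * basicForm k y j) x
      - pderiv j (fun y => coefQ c k (y 0) * basicForm k y i) x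
      + 2 * (coefQ c (k + 1) (x 0) * basicForm (k + 1) x i
          * (coefQ c (k + 2) (x 0) * basicForm (k + 2) x j)
        - coefQ c (k + 2) (x 0) * basicForm (k + 2) x i
          * (coefQ c (k + 1) (x 0) * basicForm (k + 1) x j)) =
      -conf c (x 0) * ((coframe c x)ᵀ * unitQ k * coframe c x) i j := by
  obtain ⟨h1, h2, h3⟩ := hx
  have hs := sCoef_sq h2
  have hs0 := (sCoef_pos h2).ne'
  have h2' := h2.ne'
  have h3' : x 0 + c * 2 ≠ 0 := by rwa [mul_comm c]
  have t1 : coefQ' c 0 (x 0) = conf c (x 0) * pCoef c (x 0) := by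
    simp only [coefQ', conf, pCoef, Matrix.cons_val]
    field_simp
  have t2 : -2 * coefQ c 0 (x 0) + 2 * (coefQ c 1 (x 0) * coefQ c 2 (x 0)) =
      -conf c (x 0) * sCoef c (x 0) ^ 2 := by
    simp only [coefQ, conf, Matrix.cons_val]
    field_simp
    rw [hs]
    ring
  have t3 : coefQ' c 1 (x 0) = conf c (x 0) * sCoef c (x 0) := by
    simp only [coefQ', conf, Matrix.cons_val]
    field_simp
    rw [hs]
    ring
  have t4 : -2 * (coefQ c 2 (x 0) * coefQ c 0 (x 0)) =
      conf c (x 0) * (pCoef c (x 0) * sCoef c (x 0)) := by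
    simp only [coefQ, conf, pCoef, Matrix.cons_val]
    field_simp
  have t5 : coefQ' c 2 (x 0) = -(conf c (x 0) * sCoef c (x 0)) := by
    simp only [coefQ', conf, Matrix.cons_val]
    field_simp
    rw [hs]
    ring
  have t6 : 2 * (coefQ c 0 (x 0) * coefQ c 1 (x 0)) =
      conf c (x 0) * (pCoef c (x 0) * sCoef c (x 0)) := by
    simp only [coefQ, conf, pCoef, Matrix.cons_val]
    field_simp
  have hd : ∀ i j, pderiv i (fun y => coefQ c k (y 0) * basicForm k y j) x = _ := fun i j =>
    pderiv_radial_mul (hasDerivAt_coefQ h1 h2 k) (differentiableAt_basicForm x k j) i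
  have e1 : (1 : Fin 3) + 2 = 0 := rfl
  have e2 : (2 : Fin 3) + 2 = 1 := rfl
  have e3 : (2 : Fin 3) + 1 = 0 := rfl
  have e4 : (1 : Fin 3) + 1 = 2 := rfl
  rw [hd, hd, pderiv_basicForm, pderiv_basicForm]
  clear hd
  simp only [Matrix.mul_apply, Fin.sum_univ_four, Matrix.transpose_apply, coframe_eq]
  generalize (Pi.single 0 1 : Fin 4 → ℝ) = e
  fin_cases k <;> simp only [Fin.zero_eta, Fin.mk_one, Fin.reduceFinMk, unitQ, Matrix.cons_val,
    Matrix.of_apply, e1, e2, e3, e4, zero_add] <;>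
    generalize basicForm 0 x = η, basicForm 1 x = X, basicForm 2 x = Y
  · linear_combination (e i * η j - e j * η i) * t1 + (X i * Y j - X j * Y i) * t2
  · linear_combination (e i * X j - e j * X i) * t3 + (η i * Y j - η j * Y i) * t4
  · linear_combination (e i * Y j - e j * Y i) * t5 + (η i * X j - η j * X i) * t6

/-- The commuting `sp(1)`-curvature is also diagonal, but its factor depends on `k` and `ρ`. No
equality of factors is needed on this side. -/
lemma structure_coefC (hx : x ∈ regularSet c) (k : Fin 3) (i j : Fin 4) :
    pderiv i (fun y => coefC c k (y 0) * basicForm k y j) x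
      - pderiv j (fun y => coefC c k (y 0) * basicForm k y i) x
      + 2 * (coefC c (k + 1) (x 0) * basicForm (k + 1) x i
          * (coefC c (k + 2) (x 0) * basicForm (k + 2) x j)
        - coefC c (k + 2) (x 0) * basicForm (k + 2) x i
          * (coefC c (k + 1) (x 0) * basicForm (k + 1) x j)) =
      curvC c k (x 0) * conf c (x 0) * ((coframe c x)ᵀ * unitC k * coframe c x) i j := by
  obtain ⟨h1, h2, h3⟩ := hx
  have hs := sCoef_sq h2
  have hs0 := (sCoef_pos h2).ne'
  have h2' := h2.ne'
  have h3' : x 0 + c * 2 ≠ 0 := by rwa [mul_comm c]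
  have t1 : coefC' c 0 (x 0) = -(curvC c 0 (x 0) * conf c (x 0) * pCoef c (x 0)) := by
    simp only [coefC', conf, pCoef, curvC, Matrix.cons_val]
    field_simp
    ring
  have t2 : -2 * coefC c 0 (x 0) + 2 * (coefC c 1 (x 0) * coefC c 2 (x 0)) =
      -(curvC c 0 (x 0) * conf c (x 0) * sCoef c (x 0) ^ 2) := by
    simp only [coefC, conf, curvC, Matrix.cons_val]
    field_simp
    rw [hs]
    ring
  have t3 : coefC' c 1 (x 0) = -(curvC c 1 (x 0) * conf c (x 0) * sCoef c (x 0)) := by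
    simp only [coefC', conf, curvC, Matrix.cons_val]
    field_simp
    rw [hs]
    ring
  have t4 : -2 * (coefC c 2 (x 0) * coefC c 0 (x 0)) =
      curvC c 1 (x 0) * conf c (x 0) * (pCoef c (x 0) * sCoef c (x 0)) := by
    simp only [coefC, conf, pCoef, curvC, Matrix.cons_val]
    field_simp
    ring
  have t5 : coefC' c 2 (x 0) = -(curvC c 2 (x 0) * conf c (x 0) * sCoef c (x 0)) := t3
  have t6 : 2 * (coefC c 0 (x 0) * coefC c 1 (x 0)) =
      -(curvC c 2 (x 0) * conf c (x 0) * (pCoef c (x 0) * sCoef c (x 0))) := by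
    simp only [coefC, conf, pCoef, curvC, Matrix.cons_val]
    field_simp
    ring
  have hd : ∀ i j, pderiv i (fun y => coefC c k (y 0) * basicForm k y j) x = _ := fun i j =>
    pderiv_radial_mul (hasDerivAt_coefC h1 h2 h3 k) (differentiableAt_basicForm x k j) i
  have e1 : (1 : Fin 3) + 2 = 0 := rfl
  have e2 : (2 : Fin 3) + 2 = 1 := rfl
  have e3 : (2 : Fin 3) + 1 = 0 := rfl
  have e4 : (1 : Fin 3) + 1 = 2 := rfl
  rw [hd, hd, pderiv_basicForm, pderiv_basicForm]
  clear hd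
  simp only [Matrix.mul_apply, Fin.sum_univ_four, Matrix.transpose_apply, coframe_eq]
  generalize (Pi.single 0 1 : Fin 4 → ℝ) = e
  fin_cases k <;> simp only [Fin.zero_eta, Fin.mk_one, Fin.reduceFinMk, unitC, Matrix.cons_val,
    Matrix.of_apply, e1, e2, e3, e4, zero_add] <;>
    generalize basicForm 0 x = η, basicForm 1 x = X, basicForm 2 x = Y
  · linear_combination (e i * η j - e j * η i) * t1 + (X i * Y j - X j * Y i) * t2
  · linear_combination (e i * X j - e j * X i) * t3 + (η i * Y j - η j * Y i) * t4
  · linear_combination (e i * Y j - e j * Y i) * t5 + (η i * X j - η j * X i) * t6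

/-- The endomorphism with the components `A` in the coframe. -/
def conjFrame (c : ℝ) (A : Matrix (Fin 4) (Fin 4) ℝ) (x : Fin 4 → ℝ) : Matrix (Fin 4) (Fin 4) ℝ :=
  frame c x * A * coframe c x

/-- Lowering an index produces the two-forms on the right of the structure equations, up to the
factor `σ`. This is where `σ⁻¹` in the curvature comes from. -/
lemma smul_gUH_mul_conjFrame (σ : ℝ) (hx : x ∈ regularSet c) (A : Matrix (Fin 4) (Fin 4) ℝ) :
    (σ • gUH c) x * conjFrame c A x =
      (σ * conf c (x 0)) • ((coframe c x)ᵀ * A * coframe c x) := by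
  have h : (coframe c x)ᵀ * coframe c x * (frame c x * A * coframe c x) =
      (coframe c x)ᵀ * (coframe c x * frame c x) * A * coframe c x := by noncomm_ring
  rw [Pi.smul_apply, gUH_eq hx, smul_smul, Matrix.smul_mul, conjFrame, h, coframe_mul_frame hx,
    Matrix.mul_one]

lemma transpose_smul_gUH (σ : ℝ) (hx : x ∈ regularSet c) :
    ((σ • gUH c) x)ᵀ = (σ • gUH c) x := by
  rw [Pi.smul_apply, gUH_eq hx]
  simp [Matrix.transpose_mul]

lemma conjFrame_skew (σ : ℝ) (hx : x ∈ regularSet c) {A : Matrix (Fin 4) (Fin 4) ℝ}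
    (hA : Aᵀ = -A) :
    (conjFrame c A x)ᵀ * (σ • gUH c) x + (σ • gUH c) x * conjFrame c A x = 0 := by
  have h : (conjFrame c A x)ᵀ * (σ • gUH c) x = ((σ • gUH c) x * conjFrame c A x)ᵀ := by
    rw [Matrix.transpose_mul, transpose_smul_gUH σ hx]
  rw [h, smul_gUH_mul_conjFrame σ hx]
  simp [Matrix.transpose_mul, hA, Matrix.mul_assoc]

lemma conjFrame_sq (hx : x ∈ regularSet c) {A : Matrix (Fin 4) (Fin 4) ℝ} (hA : A * A = -1) :
    conjFrame c A x * conjFrame c A x = -1 := by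
  have h : conjFrame c A x * conjFrame c A x =
      frame c x * A * (coframe c x * frame c x) * A * coframe c x := by
    simp only [conjFrame]
    noncomm_ring
  rw [h, coframe_mul_frame hx, Matrix.mul_one, Matrix.mul_assoc (frame c x), hA, Matrix.mul_neg,
    Matrix.mul_one, Matrix.neg_mul, mul_eq_one_comm.1 (coframe_mul_frame hx)]

lemma conjFrame_commute (hx : x ∈ regularSet c) {A B : Matrix (Fin 4) (Fin 4) ℝ}
    (hA : A * B = B * A) :
    conjFrame c A x * conjFrame c B x = conjFrame c B x * conjFrame c A x := by
  have h : ∀ A B : Matrix (Fin 4) (Fin 4) ℝ, conjFrame c A x * conjFrame c B x =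
      frame c x * (A * B) * coframe c x := by
    intro A B
    calc conjFrame c A x * conjFrame c B x =
        frame c x * A * (coframe c x * frame c x) * B * coframe c x := by
          simp only [conjFrame]
          noncomm_ring
      _ = _ := by
          rw [coframe_mul_frame hx]
          noncomm_ring
  rw [h, h, hA]

lemma matPderiv_connForm (hx : x ∈ regularSet c) (i j : Fin 4) :
    matPderiv i (connForm c j) x =
      pderiv i (fun y => logConf c (y 0) * (Pi.single 0 1 : Fin 4 → ℝ) j) x • 1
        + ∑ k, pderiv i (fun y => coefQ c k (y 0) * basicForm k y j) x • unitQ k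
        + ∑ k, pderiv i (fun y => coefC c k (y 0) * basicForm k y j) x • unitC k := by
  have hU := isOpen_regularSet c
  have h1 := SmoothOn.smul (contDiffOn_logConf c j) (smoothOn_const 1 (regularSet c))
  have h2 := smoothOn_sum_smul (fun k => contDiffOn_coefQ c k j) unitQ
  have h3 := smoothOn_sum_smul (fun k => contDiffOn_coefC c k j) unitC
  unfold connForm
  rw [matPderiv_add hU (h1.add h2) h3 i hx, matPderiv_add hU h1 h2 i hx,
    matPderiv_sum_smul hU (fun k => contDiffOn_coefQ c k j) unitQ i hx,
    matPderiv_sum_smul hU (fun k => contDiffOn_coefC c k j) unitC i hx,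
    matPderiv_smul (A := fun _ => 1)
      (((contDiffOn_logConf c j).contDiffAt (hU.mem_nhds hx)).differentiableAt (by simp))
      (fun _ _ => differentiableAt_const _), matPderiv_const, smul_zero, add_zero]

/-- The curvature of the one-loop deformed universal hypermultiplet metric. -/
lemma curvature_gUH {σ : ℝ} (hσ : σ ≠ 0) (hx : x ∈ regularSet c) (i j : Fin 4) :
    curvature (σ • gUH c) i j x =
      kahlerTensor ((σ • gUH c) x) (fun k => conjFrame c (unitQ k) x) (fun _ => -σ⁻¹) i j
      + kahlerTensor ((σ • gUH c) x) (fun k => conjFrame c (unitC k) x)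
        (fun k => curvC c k (x 0) * σ⁻¹) i j := by
  -- The scalar part of the connection form is a function of `ρ` times `dρ`, hence closed, and drops
  -- out of the curvature.
  have hlog : pderiv i (fun y => logConf c (y 0) * (Pi.single 0 1 : Fin 4 → ℝ) j) x =
      pderiv j (fun y => logConf c (y 0) * (Pi.single 0 1 : Fin 4 → ℝ) i) x := by
    have h0 := ((contDiffAt_logConf hx.1 hx.2.1 hx.2.2).differentiableAt (by simp)).hasDerivAt
    rw [pderiv_radial_mul h0 (by fun_prop), pderiv_radial_mul h0 (by fun_prop), pderiv_const,
      pderiv_const]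
    ring
  have key : matPderiv i (connForm c j) x - matPderiv j (connForm c i) x
      + (connForm c i x * connForm c j x - connForm c j x * connForm c i x) =
      ∑ k, (-conf c (x 0) * ((coframe c x)ᵀ * unitQ k * coframe c x) i j) • unitQ k
      + ∑ k, (curvC c k (x 0) * conf c (x 0) * ((coframe c x)ᵀ * unitC k * coframe c x) i j)
        • unitC k := by
    simp only [← structure_coefQ hx, ← structure_coefC hx]
    rw [matPderiv_connForm hx, matPderiv_connForm hx, hlog]
    simp only [connForm]
    rw [commutator_quaternion unitQ_triple unitC_triple unitQ_commute]
    simp only [add_smul, sub_smul, Finset.sum_add_distrib, Finset.sum_sub_distrib]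
    abel
  rw [(isConnectionFormOn hσ c).curvature_eq i j hx, key, Matrix.mul_add, Matrix.add_mul]
  simp only [kahlerTensor, smul_gUH_mul_conjFrame σ hx, Matrix.mul_sum, Matrix.sum_mul,
    Matrix.mul_smul, Matrix.smul_mul, Matrix.smul_apply, smul_eq_mul]
  congr 1 <;> refine Finset.sum_congr rfl fun k _ => ?_ <;> rw [conjFrame] <;> congr 1 <;>
    field_simp

/-- The quaternionic structure of the one-loop deformed universal hypermultiplet. -/
def quatBundle (c : ℝ) (x : Fin 4 → ℝ) : Submodule ℝ (Matrix (Fin 4) (Fin 4) ℝ) :=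
  Submodule.span ℝ (Set.range fun k => conjFrame c (unitQ k) x)

/-- The scalar part and the commuting triple disappear from the commutator. What remains lies in the
span of `J`, which makes the bundle parallel. -/
lemma commutator_mem_span {J P : Fin 3 → Matrix (Fin 4) (Fin 4) ℝ} (hJ : IsQuaternionTriple J)
    (hJP : ∀ k l, J k * P l = P l * J k) (f : ℝ) (a b : Fin 3 → ℝ) (l : Fin 3) :
    (f • 1 + ∑ k, a k • J k + ∑ k, b k • P k) * J l
      - J l * (f • 1 + ∑ k, a k • J k + ∑ k, b k • P k) =
      (2 * a (l + 2)) • J (l + 1) - (2 * a (l + 1)) • J (l + 2) := by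
  have e1 : (1 : Fin 3) + 2 = 0 := rfl
  have e2 : (2 : Fin 3) + 2 = 1 := rfl
  have e3 : (2 : Fin 3) + 1 = 0 := rfl
  have e4 : (1 : Fin 3) + 1 = 2 := rfl
  fin_cases l <;>
  · simp only [Fin.sum_univ_three, Matrix.mul_add, Matrix.add_mul, Matrix.mul_smul,
      Matrix.smul_mul, hJ.sq, hJ.mul_eq, hJ.anticomm, hJ.zero_mul_two, hJ.two_mul_zero,
      hJ.one_mul_two, hJ.two_mul_one, hJP, Matrix.mul_one, Matrix.one_mul, Fin.zero_eta,
      Fin.mk_one, Fin.reduceFinMk, e1, e2, e3, e4, zero_add]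
    module

lemma isQuaternionicStructureOn {σ : ℝ} (hσ : σ ≠ 0) {U : Set (Fin 4 → ℝ)} (hU : IsOpen U)
    (hUc : U ⊆ regularSet c) : IsQuaternionicStructureOn (σ • gUH c) U (quatBundle c) where
  exists_parallel_frame p hp := by
    refine ⟨U, Subset.rfl, hU, hp, fun k => conjFrame c (unitQ k), ?_, fun x _ => rfl, ?_⟩
    · have hQ : ∀ x ∈ U, IsQuaternionTriple fun k => conjFrame c (unitQ k) x := fun x hx =>
        unitQ_triple.conj (coframe_mul_frame (hUc hx))
      refine ⟨fun a i j => ?_, fun x hx => (hQ x hx).sq_zero, fun x hx => (hQ x hx).sq_one,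
        fun x hx => (hQ x hx).mul_eq, fun x hx => (hQ x hx).anticomm,
        fun a x hx => conjFrame_skew σ (hUc hx) (unitQ_skew a)⟩
      exact (((smoothOn_frame c).mul (smoothOn_const (unitQ a) _)).mul
        (smoothOn_coframe c) i j).mono hUc
    · intro a i x hx
      have h := (isConnectionFormOn hσ c).covDerivEnd_conj (unitQ a) i (hUc hx)
      change covDerivEnd (σ • gUH c) i (fun y => frame c y * unitQ a * coframe c y) x ∈ _
      rw [h, connForm, commutator_mem_span unitQ_triple unitQ_commute]
      simp only [Matrix.mul_sub, Matrix.sub_mul, Matrix.mul_smul, Matrix.smul_mul]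
      exact Submodule.sub_mem _ (Submodule.smul_mem _ _ (Submodule.subset_span ⟨a + 1, rfl⟩))
        (Submodule.smul_mem _ _ (Submodule.subset_span ⟨a + 2, rfl⟩))
  annihilates_curvature x hx A hA i j := by
    simp only [curvature_gUH hσ (hUc hx)]
    exact annihilates_kahlerTensor (unitQ_triple.conj (coframe_mul_frame (hUc hx)))
      (fun k => conjFrame_skew σ (hUc hx) (unitQ_skew k))
      (fun k l => conjFrame_commute (hUc hx) (unitQ_commute k l)) _ _ hA i j

lemma isUnit_det_gUH {σ : ℝ} (hσ : σ ≠ 0) (hx : x ∈ regularSet c) :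
    IsUnit ((σ • gUH c) x).det := by
  have h1 : (coframe c x).det ≠ 0 := fun h0 => by
    have := congrArg Matrix.det (coframe_mul_frame hx)
    rw [Matrix.det_mul, h0, zero_mul, Matrix.det_one] at this
    exact zero_ne_one this
  have h2 : conf c (x 0) ≠ 0 := div_ne_zero hx.2.2
      (mul_ne_zero (mul_ne_zero four_ne_zero (pow_ne_zero 2 hx.1)) hx.2.1.ne')
  rw [Pi.smul_apply, gUH_eq hx, smul_smul, Matrix.det_smul, Matrix.det_mul, Matrix.det_transpose]
  exact (mul_ne_zero (pow_ne_zero _ (mul_ne_zero hσ h2)) (mul_ne_zero h1 h1)).isUnit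

/-- The value is `4 (-3 - 3) / σ`: the terms `r ^ 3 / (r + 2 * c) ^ 3` cancel in the sum of `curvC`.
-/
lemma scalarCurvature_gUH {σ : ℝ} (hσ : σ ≠ 0) (hx : x ∈ regularSet c) :
    scalarCurvature (σ • gUH c) x = -24 * σ⁻¹ := by
  rw [scalarCurvature_eq (transpose_smul_gUH σ hx) (isUnit_det_gUH hσ hx)
    (fun k => conjFrame_sq hx (unitQ_triple.sq k)) (fun k => conjFrame_skew σ hx (unitQ_skew k))
    (fun k => conjFrame_sq hx (unitC_triple.sq k)) (fun k => conjFrame_skew σ hx (unitC_skew k))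
    (curvature_gUH hσ hx)]
  simp [Fin.sum_univ_three, curvC]
  ring

/-- The metric in terms of the one-forms of the coframe. -/
lemma quadForm_gUH (σ : ℝ) (hx : x ∈ regularSet c) (v : Fin 4 → ℝ) :
    v ⬝ᵥ ((σ • gUH c) x *ᵥ v) = σ * conf c (x 0) * (v 0 ^ 2
      + (pCoef c (x 0) * (v 1 + x 3 * v 2 - x 2 * v 3)) ^ 2
      + 2 * (x 0 + c) * (v 2 ^ 2 + v 3 ^ 2)) := by
  rw [← sCoef_sq hx.2.1, Pi.smul_apply, gUH_eq hx, smul_smul, Matrix.smul_mulVec, dotProduct_smul,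
    ← Matrix.mulVec_mulVec, Matrix.dotProduct_mulVec, Matrix.vecMul_transpose]
  rw [smul_eq_mul]
  congr 1
  simp [dotProduct, Matrix.mulVec, Fin.sum_univ_four, coframe]
  ring

lemma isRiemannianOn {σ : ℝ} {U : Set (Fin 4 → ℝ)} (hU : IsOpen U) (hUc : U ⊆ regularSet c)
    (hpos : ∀ x ∈ U, 0 < σ * (x 0 + 2 * c)) : IsRiemannianOn (σ • gUH c) U where
  isOpen := hU
  smooth i j := by
    have h := SmoothOn.smul (contDiffOn_const (c := σ)) (SmoothOn.smul
      (contDiffOn_radial fun x hx => contDiffAt_conf hx.1 hx.2.1)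
      ((smoothOn_coframe c).transpose.mul (smoothOn_coframe c)))
    refine ((h i j).mono hUc).congr fun x hx => ?_
    rw [Pi.smul_apply, gUH_eq (hUc hx)]
  posDef x hx := by
    have hc : 0 < σ * conf c (x 0) := by
      have h1 := sq_pos_of_ne_zero (hUc hx).1
      have h2 := (hUc hx).2.1
      rw [conf, ← mul_div_assoc]
      exact div_pos (hpos x hx) (by positivity)
    refine Matrix.PosDef.of_dotProduct_mulVec_pos ?_ fun v hv => ?_
    · rw [Matrix.IsHermitian, Matrix.conjTranspose_eq_transpose_of_trivial]
      exact transpose_smul_gUH σ (hUc hx)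
    · rw [star_trivial, quadForm_gUH σ (hUc hx)]
      refine mul_pos hc ?_
      by_contra hle
      have hA := (hUc hx).2.1
      have hp : pCoef c (x 0) ≠ 0 := div_ne_zero hA.ne' (hUc hx).2.2
      have n0 := sq_nonneg (v 0)
      have n1 := sq_nonneg (pCoef c (x 0) * (v 1 + x 3 * v 2 - x 2 * v 3))
      have n2 : 0 ≤ 2 * (x 0 + c) * v 2 ^ 2 := by positivity
      have n3 : 0 ≤ 2 * (x 0 + c) * v 3 ^ 2 := by positivity
      have z0 : v 0 = 0 := pow_eq_zero_iff two_ne_zero |>.1 (by linarith)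
      have z1 : pCoef c (x 0) * (v 1 + x 3 * v 2 - x 2 * v 3) = 0 :=
        pow_eq_zero_iff two_ne_zero |>.1 (by linarith)
      have z2 : 2 * (x 0 + c) * v 2 ^ 2 = 0 := by linarith
      have z3 : 2 * (x 0 + c) * v 3 ^ 2 = 0 := by linarith
      have z2' : v 2 = 0 := by simpa [hA.ne'] using z2
      have z3' : v 3 = 0 := by simpa [hA.ne'] using z3
      have z1' : v 1 = 0 := by simpa [hp, z2', z3'] using z1
      refine hv (funext fun i => ?_)
      fin_cases i <;> simp [z0, z1', z2', z3']

lemma isQuaternionicKahlerOn {σ : ℝ} {U : Set (Fin 4 → ℝ)} (hU : IsOpen U)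
    (hUc : U ⊆ regularSet c) (hσ : σ ≠ 0) (hpos : ∀ x ∈ U, 0 < σ * (x 0 + 2 * c)) :
    IsQuaternionicKahlerOn (σ • gUH c) U :=
  ⟨isRiemannianOn hU hUc hpos, quatBundle c, isQuaternionicStructureOn hσ hU hUc⟩

end UH
end

noncomputable section

namespace CoordGeom

variable {n : ℕ}

/-! ### Estimates for the Riemannian distance -/

/-- Integrate the derivative of `h` along the curve. The bound is stated at every time `t`, not only
at the endpoint, because confining a whole curve to a box requires it. -/
lemma ofReal_abs_sub_le_mul_curveLength {g : (Fin n → ℝ) → Matrix (Fin n) (Fin n) ℝ}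
    {O : Set (Fin n → ℝ)} (hO : IsOpen O) {h : (Fin n → ℝ) → ℝ} (hh : ContDiffOn ℝ 1 h O)
    {γ : ℝ → Fin n → ℝ} (hγ : ContDiffOn ℝ 1 γ (Icc 0 1)) (hγO : MapsTo γ (Icc 0 1) O) {K : ℝ}
    (hK : 0 ≤ K) (hb : ∀ s ∈ Icc (0 : ℝ) 1, ∀ v, |fderiv ℝ h (γ s) v| ≤
      K * √(v ⬝ᵥ (g (γ s) *ᵥ v))) {t : ℝ} (ht : t ∈ Icc (0 : ℝ) 1) :
    ENNReal.ofReal |h (γ t) - h (γ 0)| ≤ ENNReal.ofReal K * curveLength g γ := by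
  rcases ht.1.eq_or_lt with rfl | h0
  · simp
  have hsub : Icc (0 : ℝ) t ⊆ Icc 0 1 := Icc_subset_Icc_right ht.2
  have hc : ContDiffOn ℝ 1 (h ∘ γ) (Icc 0 t) := hh.comp (hγ.mono hsub) fun s hs => hγO (hsub hs)
  have key := enorm_sub_le_lintegral_derivWithin_Icc_of_contDiffOn_Icc hc h0.le
  rw [← ofReal_norm, Real.norm_eq_abs] at key
  refine key.trans ?_
  rw [curveLength, ← lintegral_const_mul' _ _ ENNReal.ofReal_ne_top]
  refine le_trans (setLIntegral_mono' measurableSet_Icc fun s hs => ?_)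
    (lintegral_mono_set hsub)
  have hs' := hsub hs
  have h1 : HasDerivWithinAt γ (derivWithin γ (Icc 0 1) s) (Icc 0 t) s :=
    ((hγ.differentiableOn one_ne_zero s hs').hasDerivWithinAt).mono hsub
  have h2 : HasFDerivAt h (fderiv ℝ h (γ s)) (γ s) :=
    ((hh.contDiffAt (hO.mem_nhds (hγO hs'))).differentiableAt one_ne_zero).hasFDerivAt
  have h3 := (h2.comp_hasDerivWithinAt s h1).derivWithin ((uniqueDiffOn_Icc h0) s hs)
  rw [h3, ← ofReal_norm, Real.norm_eq_abs, ← ENNReal.ofReal_mul hK]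
  exact ENNReal.ofReal_le_ofReal (hb s hs' _)

lemma abs_sub_le_of_curveLength_lt {g : (Fin n → ℝ) → Matrix (Fin n) (Fin n) ℝ}
    {O : Set (Fin n → ℝ)} (hO : IsOpen O) {h : (Fin n → ℝ) → ℝ} (hh : ContDiffOn ℝ 1 h O)
    {γ : ℝ → Fin n → ℝ} (hγ : ContDiffOn ℝ 1 γ (Icc 0 1)) (hγO : MapsTo γ (Icc 0 1) O) {K : ℝ}
    (hK : 0 ≤ K) (hb : ∀ s ∈ Icc (0 : ℝ) 1, ∀ v, |fderiv ℝ h (γ s) v| ≤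
      K * √(v ⬝ᵥ (g (γ s) *ᵥ v))) {δ : ℝ} (hδ : 0 ≤ δ) (hl : curveLength g γ < ENNReal.ofReal δ)
    {t : ℝ} (ht : t ∈ Icc (0 : ℝ) 1) : |h (γ t) - h (γ 0)| ≤ K * δ := by
  have h1 := (ofReal_abs_sub_le_mul_curveLength hO hh hγ hγO hK hb ht).trans
    (mul_le_mul_right hl.le _)
  rwa [← ENNReal.ofReal_mul hK, ENNReal.ofReal_le_ofReal_iff (mul_nonneg hK hδ)] at h1

lemma exists_curve_of_riemDist_lt {g : (Fin n → ℝ) → Matrix (Fin n) (Fin n) ℝ}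
    {U : Set (Fin n → ℝ)} {x y : Fin n → ℝ} {ε : ℝ≥0∞} (h : riemDist g U x y < ε) :
    ∃ γ : ℝ → Fin n → ℝ, ContDiffOn ℝ 1 γ (Icc 0 1) ∧ MapsTo γ (Icc 0 1) U ∧ γ 0 = x ∧ γ 1 = y ∧
      curveLength g γ < ε := by
  simp only [riemDist, iInf_lt_iff] at h
  obtain ⟨γ, h1, h2, h3, h4, h5⟩ := h
  exact ⟨γ, h1, h2, h3, h4, h5⟩

lemma abs_sub_le_of_riemDist_lt {g : (Fin n → ℝ) → Matrix (Fin n) (Fin n) ℝ}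
    {U : Set (Fin n → ℝ)} (hU : IsOpen U) {h : (Fin n → ℝ) → ℝ} (hh : ContDiffOn ℝ 1 h U) {K : ℝ}
    (hK : 0 ≤ K) (hb : ∀ x ∈ U, ∀ v, |fderiv ℝ h x v| ≤ K * √(v ⬝ᵥ (g x *ᵥ v)))
    {x y : Fin n → ℝ} {δ : ℝ} (hδ : 0 ≤ δ) (hl : riemDist g U x y < ENNReal.ofReal δ) :
    |h y - h x| ≤ K * δ := by
  obtain ⟨γ, h1, h2, rfl, rfl, h5⟩ := exists_curve_of_riemDist_lt hl
  exact abs_sub_le_of_curveLength_lt hU hh h1 h2 hK (fun s hs => hb _ (h2 hs)) hδ h5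
    (right_mem_Icc.2 zero_le_one)

/-- A Lipschitz function obstructing the convergence of a Cauchy sequence. -/
lemma not_isCompleteOn {g : (Fin n → ℝ) → Matrix (Fin n) (Fin n) ℝ}
    {U : Set (Fin n → ℝ)} (hU : IsOpen U) {h : (Fin n → ℝ) → ℝ} (hh : ContDiffOn ℝ 1 h U) {K : ℝ}
    (hK : 0 ≤ K) (hb : ∀ x ∈ U, ∀ v, |fderiv ℝ h x v| ≤ K * √(v ⬝ᵥ (g x *ᵥ v)))
    {u : ℕ → Fin n → ℝ} (hu : ∀ k, u k ∈ U)
    (hcauchy : ∀ ε : ℝ≥0∞, 0 < ε → ∃ N, ∀ k ≥ N, ∀ l ≥ N, riemDist g U (u k) (u l) < ε)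
    {L : ℝ} (hL : Tendsto (fun k => h (u k)) atTop (𝓝 L)) (hne : ∀ x ∈ U, h x ≠ L) :
    ¬ IsCompleteOn g U := by
  intro hcomplete
  obtain ⟨x, hx, hlim⟩ := hcomplete u hu hcauchy
  have h1 : Tendsto (fun k => |h x - h (u k)|) atTop (𝓝 |h x - L|) :=
    (tendsto_const_nhds.sub hL).abs
  have h2 : ∀ δ > 0, |h x - L| ≤ K * δ := by
    intro δ hδ
    refine le_of_tendsto h1 ?_
    filter_upwards [hlim.eventually_lt_const (ENNReal.ofReal_pos.2 hδ)] with k hk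
    exact abs_sub_le_of_riemDist_lt hU hh hK hb hδ.le hk
  have h3 : |h x - L| ≤ 0 := by
    have h4 : Tendsto (fun δ : ℝ => K * δ) (𝓝[>] 0) (𝓝 0) := by
      have : Tendsto (fun δ : ℝ => K * δ) (𝓝 0) (𝓝 (K * 0)) := tendsto_id.const_mul K
      rw [mul_zero] at this
      exact this.mono_left nhdsWithin_le_nhds
    exact ge_of_tendsto h4 (by filter_upwards [self_mem_nhdsWithin] with δ hδ using h2 δ hδ)
  exact hne x hx (sub_eq_zero.1 (abs_nonpos_iff.1 h3))

lemma riemDist_le {g : (Fin n → ℝ) → Matrix (Fin n) (Fin n) ℝ} {U : Set (Fin n → ℝ)}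
    {γ : ℝ → Fin n → ℝ} (hγ : ContDiffOn ℝ 1 γ (Icc 0 1)) (hγU : MapsTo γ (Icc 0 1) U) {M : ℝ}
    (hM : ∀ t ∈ Icc (0 : ℝ) 1, √(derivWithin γ (Icc 0 1) t ⬝ᵥ
      (g (γ t) *ᵥ derivWithin γ (Icc 0 1) t)) ≤ M) :
    riemDist g U (γ 0) (γ 1) ≤ ENNReal.ofReal M := by
  have h1 : riemDist g U (γ 0) (γ 1) ≤ curveLength g γ :=
    iInf_le_of_le γ (iInf_le_of_le hγ (iInf_le_of_le hγU (iInf_le_of_le rfl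
      (iInf_le_of_le rfl le_rfl))))
  refine h1.trans ?_
  calc curveLength g γ ≤ ∫⁻ _ in Icc (0 : ℝ) 1, ENNReal.ofReal M :=
        setLIntegral_mono' measurableSet_Icc fun t ht => ENNReal.ofReal_le_ofReal (hM t ht)
    _ = ENNReal.ofReal M := by simp

/-- Convergence in the coordinates implies convergence for the Riemannian distance. -/
lemma tendsto_riemDist {g : (Fin n → ℝ) → Matrix (Fin n) (Fin n) ℝ} {U : Set (Fin n → ℝ)}
    (hU : IsOpen U) (hg : ∀ i j, ContinuousOn (fun x => g x i j) U) {u : ℕ → Fin n → ℝ}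
    {x : Fin n → ℝ} (hx : x ∈ U) (hu : Tendsto u atTop (𝓝 x)) :
    Tendsto (fun k => riemDist g U (u k) x) atTop (𝓝 0) := by
  -- The bound is made strict so that it persists in a neighbourhood of `x`. Straight segments
  -- inside a ball there then have length at most a constant times the coordinate distance.
  obtain ⟨B, hB⟩ : ∃ B : ℝ, ∀ i j, |g x i j| < B := by
    refine ⟨∑ i, ∑ j, |g x i j| + 1, fun i j => ?_⟩
    have h1 : |g x i j| ≤ ∑ j, |g x i j| :=
      Finset.single_le_sum (f := fun j => |g x i j|) (fun _ _ => abs_nonneg _) (Finset.mem_univ j)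
    have h2 : ∑ j, |g x i j| ≤ ∑ i, ∑ j, |g x i j| :=
      Finset.single_le_sum (f := fun i => ∑ j, |g x i j|)
        (fun _ _ => Finset.sum_nonneg fun _ _ => abs_nonneg _) (Finset.mem_univ i)
    linarith
  have hev : ∀ᶠ y in 𝓝 x, y ∈ U ∧ ∀ i j, |g y i j| < B := by
    refine Eventually.and (hU.mem_nhds hx) ?_
    simp only [eventually_all]
    intro i j
    exact (((hg i j).continuousAt (hU.mem_nhds hx)).abs).eventually_lt_const (hB i j)
  obtain ⟨r, hr, hball⟩ := Metric.eventually_nhds_iff_ball.1 hev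
  have hle : ∀ y ∈ Metric.ball x r, riemDist g U y x ≤
      ENNReal.ofReal (√((n * n : ℝ) * B) * ‖x - y‖) := by
    intro y hy
    have hseg : ∀ t ∈ Icc (0 : ℝ) 1, AffineMap.lineMap y x t ∈ Metric.ball x r := fun t ht =>
      (convex_ball x r).lineMap_mem hy (Metric.mem_ball_self hr) ht
    have hder : ∀ t ∈ Icc (0 : ℝ) 1,
        derivWithin (fun t : ℝ => AffineMap.lineMap y x t) (Icc 0 1) t = x - y := fun t ht =>
      (AffineMap.hasDerivWithinAt_lineMap (a := y) (b := x)).derivWithin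
        (uniqueDiffOn_Icc zero_lt_one t ht)
    have h1 := riemDist_le (g := g) (U := U) (γ := fun t : ℝ => AffineMap.lineMap y x t)
      (M := √((n * n : ℝ) * B) * ‖x - y‖)
      (by simp only [AffineMap.lineMap_apply_module]; fun_prop)
      (fun t ht => (hball _ (hseg t ht)).1) ?_
    · simpa using h1
    · intro t ht
      rw [hder t ht]
      refine Real.sqrt_le_iff.2 ⟨by positivity, ?_⟩
      have hB0 := (hball _ (hseg t ht)).2
      set z := AffineMap.lineMap y x t
      have h2 : ∀ i j, (x - y) i * (g z i j * (x - y) j) ≤ B * ‖x - y‖ ^ 2 := by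
        intro i j
        have e1 := norm_le_pi_norm (x - y) i
        have e2 := norm_le_pi_norm (x - y) j
        rw [Real.norm_eq_abs] at e1 e2
        have hBp : 0 ≤ B := (abs_nonneg _).trans (hB0 i j).le
        calc (x - y) i * (g z i j * (x - y) j) ≤ |(x - y) i| * (|g z i j| * |(x - y) j|) := by
              rw [← abs_mul, ← abs_mul]
              exact le_abs_self _
          _ ≤ ‖x - y‖ * (B * ‖x - y‖) := by
              gcongr
              exact (hB0 i j).le
          _ = _ := by ring
      calc (x - y) ⬝ᵥ (g z *ᵥ (x - y)) = ∑ i, ∑ j, (x - y) i * (g z i j * (x - y) j) := by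
            simp only [dotProduct, Matrix.mulVec, Finset.mul_sum]
        _ ≤ ∑ _i : Fin n, ∑ _j : Fin n, B * ‖x - y‖ ^ 2 :=
            Finset.sum_le_sum fun i _ => Finset.sum_le_sum fun j _ => h2 i j
        _ = (n * n : ℝ) * B * ‖x - y‖ ^ 2 := by simp; ring
        _ ≤ _ := by
            rw [mul_pow]
            gcongr
            rw [Real.sq_sqrt']
            exact le_max_left _ _
  refine tendsto_of_tendsto_of_tendsto_of_le_of_le' tendsto_const_nhds (?_ :
    Tendsto (fun k => ENNReal.ofReal (√((n * n : ℝ) * B) * ‖x - u k‖)) atTop (𝓝 0))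
    (Eventually.of_forall fun _ => bot_le) ?_
  · have h1 : Tendsto (fun k => √((n * n : ℝ) * B) * ‖x - u k‖) atTop
        (𝓝 (√((n * n : ℝ) * B) * ‖x - x‖)) := ((tendsto_const_nhds.sub hu).norm).const_mul _
    simpa using ENNReal.tendsto_ofReal h1
  · filter_upwards [hu.eventually (Metric.ball_mem_nhds x hr)] with k hk using hle _ hk

end CoordGeom
end

noncomputable section

namespace UH

open CoordGeom

/-! ### Incompleteness -/

variable {c : ℝ}

lemma abs_le_mul_sqrt {a q K : ℝ} (hK : 0 ≤ K) (h : a ^ 2 ≤ K ^ 2 * q) : |a| ≤ K * √q := by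
  have h1 := Real.abs_le_sqrt h
  rwa [Real.sqrt_mul (sq_nonneg K), Real.sqrt_sq hK] at h1

lemma conf_pos {σ r : ℝ} (h1 : r ≠ 0) (h2 : 0 < r + c) (h3 : 0 < σ * (r + 2 * c)) :
    0 < σ * conf c r := by
  have h := sq_pos_of_ne_zero h1
  rw [conf, ← mul_div_assoc]
  exact div_pos h3 (by positivity)

lemma fderiv_radial {f : ℝ → ℝ} {f' : ℝ} {x : Fin 4 → ℝ} (hf : HasDerivAt f f' (x 0))
    (v : Fin 4 → ℝ) : fderiv ℝ (fun y : Fin 4 → ℝ => f (y 0)) x v = f' * v 0 := by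
  have h0 : HasFDerivAt (fun y : Fin 4 → ℝ => y 0) (ContinuousLinearMap.proj 0) x :=
    hasFDerivAt_apply (𝕜 := ℝ) 0 x
  have h1 : HasFDerivAt (fun y : Fin 4 → ℝ => f (y 0)) _ x := hf.comp_hasFDerivAt x h0
  rw [h1.fderiv]
  simp

/-- For a function of `ρ` only the `dρ²` term of the metric matters, so a Lipschitz bound reduces to
one inequality between functions of `ρ`. -/
lemma abs_fderiv_radial_le {σ : ℝ} {x : Fin 4 → ℝ} (hx : x ∈ regularSet c)
    (hpos : 0 < σ * (x 0 + 2 * c)) {f : ℝ → ℝ} {f' : ℝ} (hf : HasDerivAt f f' (x 0)) {K : ℝ}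
    (hK : 0 ≤ K) (hb : f' ^ 2 ≤ K ^ 2 * (σ * conf c (x 0))) (v : Fin 4 → ℝ) :
    |fderiv ℝ (fun y : Fin 4 → ℝ => f (y 0)) x v| ≤ K * √(v ⬝ᵥ ((σ • gUH c) x *ᵥ v)) := by
  rw [fderiv_radial hf]
  refine abs_le_mul_sqrt hK ?_
  have hc := (conf_pos hx.1 hx.2.1 hpos).le
  have hA := hx.2.1.le
  rw [quadForm_gUH σ hx, mul_pow]
  calc f' ^ 2 * v 0 ^ 2 ≤ K ^ 2 * (σ * conf c (x 0)) * v 0 ^ 2 := by gcongr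
    _ = K ^ 2 * (σ * conf c (x 0) * v 0 ^ 2) := by ring
    _ ≤ _ := by
      gcongr
      rw [add_assoc]
      exact le_add_of_nonneg_right (by positivity)

/-- The curve `ρ = r² - c` with the other coordinates zero. -/
def ray (c r : ℝ) : Fin 4 → ℝ := ![-c + r ^ 2, 0, 0, 0]

/-- With `ρ = r² - c` the squared speed per unit of `r` is `σ (r² + c) / (r² - c)²`: the
substitution absorbs the pole of the metric at `ρ = -c`. The hypothesis `hD` says that this is at
most `D`. -/
lemma riemDist_ray_le {σ D : ℝ} {U : Set (Fin 4 → ℝ)} (hUc : U ⊆ regularSet c) {I : Set ℝ}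
    (hI : Convex ℝ I) (hI0 : ∀ r ∈ I, 0 < r) (hIU : ∀ r ∈ I, ray c r ∈ U)
    (hD : ∀ r ∈ I, σ * (r ^ 2 + c) ≤ D * (-c + r ^ 2) ^ 2) {r r' : ℝ} (hr : r ∈ I)
    (hr' : r' ∈ I) :
    riemDist (σ • gUH c) U (ray c r) (ray c r') ≤ ENNReal.ofReal (√D * |r' - r|) := by
  have hmem : ∀ t ∈ Icc (0 : ℝ) 1, r + t * (r' - r) ∈ I := fun t ht => by
    have := hI.add_smul_sub_mem hr hr' ht
    rwa [smul_eq_mul] at this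
  have hder : ∀ t : ℝ, HasDerivAt (fun t => ray c (r + t * (r' - r)))
      ![2 * (r + t * (r' - r)) * (r' - r), 0, 0, 0] t := by
    intro t
    rw [hasDerivAt_pi]
    intro i
    fin_cases i <;> simp [ray, hasDerivAt_const]
    have h := (((hasDerivAt_id t).mul_const (r' - r)).const_add r).pow 2
    refine h.congr_deriv ?_
    simp
  have h1 := riemDist_le (g := σ • gUH c) (U := U) (γ := fun t => ray c (r + t * (r' - r)))
    (M := √D * |r' - r|) ?_ (fun t ht => hIU _ (hmem t ht)) ?_
  · simpa using h1
  · rw [contDiffOn_pi]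
    intro i
    fin_cases i <;> simp [ray] <;> fun_prop
  · intro t ht
    have hR := hmem t ht
    rw [(hder t).hasDerivWithinAt.derivWithin (uniqueDiffOn_Icc zero_lt_one t ht),
      quadForm_gUH σ (hUc (hIU _ hR))]
    set R := r + t * (r' - r)
    have hR0 := hI0 R hR
    have hreg := (hUc (hIU _ hR)).1
    simp only [ray, Matrix.cons_val_zero] at hreg
    have e : σ * conf c (-c + R ^ 2) * (2 * R * (r' - r)) ^ 2 =
        σ * (R ^ 2 + c) / (-c + R ^ 2) ^ 2 * (r' - r) ^ 2 := by
      rw [conf]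
      have hA : -c + R ^ 2 + c = R ^ 2 := by ring
      rw [hA]
      field_simp
      ring
    have h2 : σ * (R ^ 2 + c) / (-c + R ^ 2) ^ 2 ≤ D :=
      (div_le_iff₀ (sq_pos_of_ne_zero hreg)).2 (hD R hR)
    simp only [ray, Matrix.cons_val]
    rw [← Real.sqrt_sq_eq_abs, ← Real.sqrt_mul' _ (sq_nonneg _)]
    apply Real.sqrt_le_sqrt
    calc _ = σ * conf c (-c + R ^ 2) * (2 * R * (r' - r)) ^ 2 := by ring
      _ ≤ _ := by
        rw [e]
        gcongr

/-- Points on the ray with `r` decreasing to `r₀` form a Cauchy sequence, since distances are at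
most `√D` times the parameter differences. The Lipschitz function `f` excludes a limit in `U`: its
limiting value is not taken there. -/
lemma not_isCompleteOn_gUH {σ D : ℝ} {U : Set (Fin 4 → ℝ)} (hU : IsOpen U)
    (hUc : U ⊆ regularSet c) (hpos : ∀ x ∈ U, 0 < σ * (x 0 + 2 * c)) {f f' : ℝ → ℝ}
    (hfc : ContDiffOn ℝ 1 (fun x : Fin 4 → ℝ => f (x 0)) U)
    (hf : ∀ x ∈ U, HasDerivAt f (f' (x 0)) (x 0)) {K : ℝ} (hK : 0 ≤ K)
    (hb : ∀ x ∈ U, f' (x 0) ^ 2 ≤ K ^ 2 * (σ * conf c (x 0))) {r₀ b : ℝ} (hr₀ : 0 ≤ r₀)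
    (hb0 : 0 < b) (hIU : ∀ r ∈ Ioo r₀ (r₀ + b), ray c r ∈ U)
    (hD : ∀ r ∈ Ioo r₀ (r₀ + b), σ * (r ^ 2 + c) ≤ D * (-c + r ^ 2) ^ 2)
    (hlim : ContinuousAt f (-c + r₀ ^ 2)) (hne : ∀ x ∈ U, f (x 0) ≠ f (-c + r₀ ^ 2)) :
    ¬ IsCompleteOn (σ • gUH c) U := by
  -- The shift by 2 keeps even the first term strictly inside the open interval.
  set s : ℕ → ℝ := fun k => r₀ + b / (k + 2) with hs
  have hsI : ∀ k, s k ∈ Ioo r₀ (r₀ + b) := by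
    intro k
    have hk : (1 : ℝ) < k + 2 := by linarith [k.cast_nonneg (α := ℝ)]
    have h1 : 0 < b / (k + 2) := by positivity
    have h2 : b / (k + 2) < b := div_lt_self hb0 hk
    exact ⟨by simp only [hs]; linarith, by simp only [hs]; linarith⟩
  have hslim : Tendsto s atTop (𝓝 r₀) := by
    have h1 : Tendsto (fun k : ℕ => (k : ℝ) + 2) atTop atTop :=
      tendsto_atTop_add_const_right _ _ tendsto_natCast_atTop_atTop
    simpa using (h1.const_div_atTop b).const_add r₀
  refine not_isCompleteOn hU hfc hK
    (fun x hx => abs_fderiv_radial_le (hUc hx) (hpos x hx) (hf x hx) hK (hb x hx))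
    (u := fun k => ray c (s k)) (fun k => hIU _ (hsI k)) ?_ (L := f (-c + r₀ ^ 2)) ?_ hne
  · intro ε hε
    obtain ⟨δ, hδ, hδε⟩ : ∃ δ : ℝ, 0 < δ ∧ ENNReal.ofReal δ < ε := by
      obtain ⟨q, hq0, hqε⟩ := ENNReal.lt_iff_exists_nnreal_btwn.1 hε
      exact ⟨q, by exact_mod_cast hq0, by simpa using hqε⟩
    have hD1 : 0 < √D + 1 := by positivity
    obtain ⟨N, hN⟩ := Metric.cauchySeq_iff.1 hslim.cauchySeq (δ / (√D + 1)) (by positivity)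
    refine ⟨N, fun k hk l hl => lt_of_le_of_lt ?_ hδε⟩
    refine (riemDist_ray_le hUc (convex_Ioo r₀ (r₀ + b)) (fun r hr => hr₀.trans_lt hr.1) hIU hD
      (hsI k) (hsI l)).trans (ENNReal.ofReal_le_ofReal ?_)
    have h1 := hN l hl k hk
    rw [Real.dist_eq, lt_div_iff₀ hD1] at h1
    nlinarith [abs_nonneg (s l - s k)]
  · have h1 : Tendsto (fun k => -c + s k ^ 2) atTop (𝓝 (-c + r₀ ^ 2)) :=
      (hslim.pow 2).const_add _
    exact hlim.tendsto.comp h1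

end UH
end

noncomputable section

namespace UH

open CoordGeom

/-! ### Completeness for `0 < c` on `{ρ > 0}` -/

section complete

variable {c : ℝ}

lemma mem_regularSet_of_pos (hc : 0 < c) {x : Fin 4 → ℝ} (hx : 0 < x 0) : x ∈ regularSet c :=
  ⟨hx.ne', by linarith, by linarith⟩

lemma isOpen_pos : IsOpen {x : Fin 4 → ℝ | 0 < x 0} := isOpen_lt (by fun_prop) (by fun_prop)

lemma quadForm_gUH_one (hc : 0 < c) {x : Fin 4 → ℝ} (hx : 0 < x 0) (v : Fin 4 → ℝ) :
    v ⬝ᵥ (gUH c x *ᵥ v) = conf c (x 0) * (v 0 ^ 2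
      + (pCoef c (x 0) * (v 1 + x 3 * v 2 - x 2 * v 3)) ^ 2
      + 2 * (x 0 + c) * (v 2 ^ 2 + v 3 ^ 2)) := by
  have := quadForm_gUH 1 (mem_regularSet_of_pos hc hx) v
  rwa [one_smul, one_mul] at this

/-- The three components of the metric are dominated by the metric. -/
lemma components_le (hc : 0 < c) {x : Fin 4 → ℝ} (hx : 0 < x 0) (v : Fin 4 → ℝ) :
    v 0 ^ 2 ≤ (2 * x 0) ^ 2 * (v ⬝ᵥ (gUH c x *ᵥ v)) ∧
    (v 1 + x 3 * v 2 - x 2 * v 3) ^ 2 ≤ (3 * x 0) ^ 2 * (v ⬝ᵥ (gUH c x *ᵥ v)) ∧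
    c * v 2 ^ 2 ≤ (x 0) ^ 2 * (v ⬝ᵥ (gUH c x *ᵥ v)) ∧
    c * v 3 ^ 2 ≤ (x 0) ^ 2 * (v ⬝ᵥ (gUH c x *ᵥ v)) := by
  rw [quadForm_gUH_one hc hx]
  set r := x 0
  set w := v 1 + x 3 * v 2 - x 2 * v 3
  have hA : 0 < r + c := by linarith
  have hB : 0 < r + 2 * c := by linarith
  have e : r ^ 2 * (conf c r * (v 0 ^ 2 + (pCoef c r * w) ^ 2
      + 2 * (r + c) * (v 2 ^ 2 + v 3 ^ 2))) =
      1 / 4 * ((r + 2 * c) / (r + c) * v 0 ^ 2 + (r + c) / (r + 2 * c) * w ^ 2)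
        + (r + 2 * c) / 2 * (v 2 ^ 2 + v 3 ^ 2) := by
    have hB' : r + c * 2 ≠ 0 := by linarith
    simp only [conf, pCoef]
    field_simp
    ring
  -- In `e` the three coefficients are thus at least `1/4`, `1/8` and `c`. This gives the factors
  -- `2²` and `c`, and `8`, which is rounded up to `3²`.
  have h1 : 1 ≤ (r + 2 * c) / (r + c) := by rw [le_div_iff₀ hA]; linarith
  have h2 : 1 / 2 ≤ (r + c) / (r + 2 * c) := by rw [le_div_iff₀ hB]; linarith
  have h3 := mul_le_mul_of_nonneg_right h1 (sq_nonneg (v 0))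
  have h4 := mul_le_mul_of_nonneg_right h2 (sq_nonneg w)
  have h5 := mul_nonneg hx.le (sq_nonneg (v 2))
  have h6 := mul_nonneg hx.le (sq_nonneg (v 3))
  have h7 := mul_nonneg hc.le (sq_nonneg (v 2))
  have h8 := mul_nonneg hc.le (sq_nonneg (v 3))
  have h9 := sq_nonneg w
  have h10 := sq_nonneg (v 0)
  refine ⟨?_, ?_, ?_, ?_⟩
  · rw [mul_pow, mul_assoc, e]
    linarith
  · rw [mul_pow, mul_assoc, e]
    linarith
  · rw [e]
    linarith
  · rw [e]
    linarith

/-- The points with `m ≤ ρ ≤ M` and `|ζ̃|, |ζ| ≤ R`. -/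
def box (m M R : ℝ) : Set (Fin 4 → ℝ) := {x | m ≤ x 0 ∧ x 0 ≤ M ∧ |x 2| ≤ R ∧ |x 3| ≤ R}

lemma fderiv_coord (i : Fin 4) (x v : Fin 4 → ℝ) :
    fderiv ℝ (fun y : Fin 4 → ℝ => y i) x v = v i := by
  have h0 : HasFDerivAt (fun y : Fin 4 → ℝ => y i) (ContinuousLinearMap.proj i) x :=
    hasFDerivAt_apply (𝕜 := ℝ) i x
  rw [h0.fderiv]
  rfl

/-- Curves of length less than one starting in a box remain in a larger box. -/
lemma exists_box (hc : 0 < c) {m : ℝ} (hm : 0 < m) (M R : ℝ) :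
    ∃ m' > 0, ∃ M' R', ∀ γ : ℝ → Fin 4 → ℝ, ContDiffOn ℝ 1 γ (Icc 0 1) →
      MapsTo γ (Icc 0 1) {x | 0 < x 0} → curveLength (gUH c) γ < 1 → γ 0 ∈ box m M R →
      ∀ t ∈ Icc (0 : ℝ) 1, γ t ∈ box m' M' R' := by
  -- Since `log ρ` is 2-Lipschitz, a curve of length below 1 changes `ρ` by a factor between `exp
  -- (-2)` and `exp 2`. With `ρ` so bounded, `ζ̃` and `ζ` are Lipschitz with constant `|M| * exp 2 /
  -- √c`.
  refine ⟨m * Real.exp (-2), by positivity, M * Real.exp 2, R + |M| * Real.exp 2 / √c,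
    fun γ h1 h2 hl h0 => ?_⟩
  rw [← ENNReal.ofReal_one] at hl
  have hlog : ∀ t ∈ Icc (0 : ℝ) 1, |Real.log (γ t 0) - Real.log (γ 0 0)| ≤ 2 * 1 := by
    intro t ht
    refine abs_sub_le_of_curveLength_lt (h := fun x => Real.log (x 0)) isOpen_pos ?_ h1 h2
      zero_le_two ?_ zero_le_one hl ht
    · exact fun x hx => ((contDiff_apply ℝ ℝ (0 : Fin 4)).contDiffAt.log
        (ne_of_gt hx)).contDiffWithinAt
    · intro s hs v
      have hx : 0 < γ s 0 := h2 hs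
      rw [fderiv_radial (Real.hasDerivAt_log hx.ne')]
      refine abs_le_mul_sqrt zero_le_two ?_
      have := (components_le hc hx v).1
      rw [mul_pow, mul_assoc, mul_left_comm] at this
      rw [mul_pow, inv_pow, inv_mul_le_iff₀ (by positivity)]
      exact this
  have hρ : ∀ t ∈ Icc (0 : ℝ) 1, m * Real.exp (-2) ≤ γ t 0 ∧ γ t 0 ≤ M * Real.exp 2 := by
    intro t ht
    have ht0 : 0 < γ t 0 := h2 ht
    have h00 : 0 < γ 0 0 := h2 (left_mem_Icc.2 zero_le_one)
    have h3 := abs_le.1 (hlog t ht)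
    have e1 : γ t 0 = γ 0 0 * Real.exp (Real.log (γ t 0) - Real.log (γ 0 0)) := by
      rw [Real.exp_sub, Real.exp_log ht0, Real.exp_log h00]
      field_simp
    rw [e1]
    have hM0 : 0 ≤ M := h00.le.trans h0.2.1
    exact ⟨mul_le_mul h0.1 (Real.exp_le_exp.2 (by linarith)) (Real.exp_pos _).le h00.le,
      mul_le_mul h0.2.1 (Real.exp_le_exp.2 (by linarith)) (Real.exp_pos _).le hM0⟩
  have hζ : ∀ i : Fin 4, i = 2 ∨ i = 3 → ∀ t ∈ Icc (0 : ℝ) 1,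
      |γ t i - γ 0 i| ≤ |M| * Real.exp 2 / √c * 1 := by
    intro i hi t ht
    refine abs_sub_le_of_curveLength_lt (h := fun x => x i) isOpen_univ
      (by fun_prop) h1 (mapsTo_univ _ _) (by positivity) ?_ zero_le_one hl ht
    intro s hs v
    have hx : 0 < γ s 0 := h2 hs
    rw [fderiv_coord]
    refine abs_le_mul_sqrt (by positivity) ?_
    rw [div_pow, Real.sq_sqrt hc.le, div_mul_eq_mul_div, le_div_iff₀ hc]
    have h3 : γ s 0 ≤ |M| * Real.exp 2 :=
      (hρ s hs).2.trans (mul_le_mul_of_nonneg_right (le_abs_self M) (Real.exp_pos _).le)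
    have hq : 0 ≤ v ⬝ᵥ (gUH c (γ s) *ᵥ v) := by
      have h4 := (sq_nonneg _).trans (components_le hc hx v).1
      exact nonneg_of_mul_nonneg_right h4 (by positivity)
    have h5 : c * v i ^ 2 ≤ (γ s 0) ^ 2 * (v ⬝ᵥ (gUH c (γ s) *ᵥ v)) := by
      rcases hi with rfl | rfl
      exacts [(components_le hc hx v).2.2.1, (components_le hc hx v).2.2.2]
    calc v i ^ 2 * c = c * v i ^ 2 := mul_comm _ _
      _ ≤ _ := h5
      _ ≤ _ := by gcongr
  intro t ht
  refine ⟨(hρ t ht).1, (hρ t ht).2, ?_, ?_⟩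
  · have h3 := hζ 2 (Or.inl rfl) t ht
    have h4 := abs_sub_abs_le_abs_sub (γ t 2) (γ 0 2)
    linarith [h0.2.2.1]
  · have h3 := hζ 3 (Or.inr rfl) t ht
    have h4 := abs_sub_abs_le_abs_sub (γ t 3) (γ 0 3)
    linarith [h0.2.2.2]

/-- In a box the coordinates are Lipschitz along curves. -/
lemma exists_lipschitz (hc : 0 < c) {m : ℝ} (hm : 0 < m) (M R : ℝ) :
    ∃ C, 0 ≤ C ∧ ∀ γ : ℝ → Fin 4 → ℝ, ContDiffOn ℝ 1 γ (Icc 0 1) →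
      (∀ t ∈ Icc (0 : ℝ) 1, γ t ∈ box m M R) → ∀ δ, 0 ≤ δ →
      curveLength (gUH c) γ < ENNReal.ofReal δ → ∀ i, |γ 1 i - γ 0 i| ≤ C * δ := by
  -- One constant serves all coordinates. The costly one is `φ`, recovered from `dφ = η - ζ dζ̃ + ζ̃
  -- dζ`: `3 |M|` bounds `η`, and each of the other two terms contributes `|R| * (|M| / √c)`.
  refine ⟨3 * |M| + 2 * |R| * (|M| / √c) + |M| / √c, by positivity, fun γ h1 h2 δ hδ hl i => ?_⟩
  refine abs_sub_le_of_curveLength_lt (h := fun x => x i) isOpen_univ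
    (by fun_prop) h1 (mapsTo_univ _ _) (by positivity) ?_ hδ hl (right_mem_Icc.2 zero_le_one)
  intro s hs v
  rw [fderiv_coord]
  obtain ⟨hm', hM, hR2, hR3⟩ := h2 s hs
  have hx : 0 < γ s 0 := hm.trans_le hm'
  have hM' : γ s 0 ≤ |M| := hM.trans (le_abs_self M)
  obtain ⟨k0, k1, k2, k3⟩ := components_le hc hx v
  set q := v ⬝ᵥ (gUH c (γ s) *ᵥ v)
  have hq := Real.sqrt_nonneg q
  have hMc : 0 ≤ |M| / √c := by positivity
  have l0 : |v 0| ≤ 2 * |M| * √q :=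
    (abs_le_mul_sqrt (by positivity) k0).trans (by gcongr)
  have l1 : |v 1 + γ s 3 * v 2 - γ s 2 * v 3| ≤ 3 * |M| * √q :=
    (abs_le_mul_sqrt (by positivity) k1).trans (by gcongr)
  have lζ : ∀ a : ℝ, c * a ^ 2 ≤ (γ s 0) ^ 2 * q → |a| ≤ |M| / √c * √q := by
    intro a ha
    have h3 : |a| ≤ γ s 0 / √c * √q := by
      refine abs_le_mul_sqrt (by positivity) ?_
      rw [div_pow, Real.sq_sqrt hc.le, div_mul_eq_mul_div, le_div_iff₀ hc]
      linarith
    exact h3.trans (by gcongr)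
  have l2 := lζ _ k2
  have l3 := lζ _ k3
  have p1 : 0 ≤ |M| * √q := by positivity
  have p2 : 0 ≤ |M| / √c * √q := by positivity
  have p3 : 0 ≤ |R| * (|M| / √c * √q) := by positivity
  have e : (3 * |M| + 2 * |R| * (|M| / √c) + |M| / √c) * √q =
      3 * (|M| * √q) + 2 * (|R| * (|M| / √c * √q)) + |M| / √c * √q := by ring
  rw [e]
  fin_cases i <;> simp only [Fin.zero_eta, Fin.mk_one, Fin.reduceFinMk]
  · linarith
  · have m2 : |γ s 3 * v 2| ≤ |R| * (|M| / √c * √q) := by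
      rw [abs_mul]
      exact mul_le_mul (hR3.trans (le_abs_self R)) l2 (abs_nonneg _) (abs_nonneg _)
    have m3 : |γ s 2 * v 3| ≤ |R| * (|M| / √c * √q) := by
      rw [abs_mul]
      exact mul_le_mul (hR2.trans (le_abs_self R)) l3 (abs_nonneg _) (abs_nonneg _)
    rw [abs_le] at l1 m2 m3 ⊢
    constructor <;> linarith [l1.1, l1.2, m2.1, m2.2, m3.1, m3.2]
  · linarith
  · linarith

/-- Cauchy for the Riemannian distance implies Cauchy in the coordinates. The limit keeps the
positive lower bound on `ρ`, and coordinate convergence inside the domain gives back Riemannian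
convergence. -/
lemma isCompleteOn_gUH (hc : 0 < c) : IsCompleteOn (gUH c) {x | 0 < x 0} := by
  intro u hu hcauchy
  obtain ⟨N, hN⟩ := hcauchy 1 one_pos
  obtain ⟨m, hm, M, R, hbox⟩ := exists_box hc (hu N) (u N 0) (max |u N 2| |u N 3|)
  have hmem : ∀ k ≥ N, u k ∈ box m M R := by
    intro k hk
    obtain ⟨γ, h1, h2, h3, h4, h5⟩ := exists_curve_of_riemDist_lt (hN N le_rfl k hk)
    rw [← h4]
    refine hbox γ h1 h2 h5 ?_ 1 (right_mem_Icc.2 zero_le_one)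
    rw [h3]
    exact ⟨le_rfl, le_rfl, le_max_left _ _, le_max_right _ _⟩
  -- The first box contains the tail of the sequence, but short curves joining its points may leave
  -- it. This second box contains those curves.
  obtain ⟨m', hm', M', R', hbox'⟩ := exists_box hc hm M R
  obtain ⟨C, hC, hlip⟩ := exists_lipschitz hc hm' M' R'
  have hcs : CauchySeq u := by
    rw [Metric.cauchySeq_iff]
    intro ε hε
    -- The bound by 1 allows `hbox'` to be applied; the other bound makes `C * δ` strictly smaller
    -- than `ε`.
    set δ := min 1 (ε / (2 * (C + 1)))
    have hδ : 0 < δ := by positivity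
    obtain ⟨N', hN'⟩ := hcauchy (ENNReal.ofReal δ) (ENNReal.ofReal_pos.2 hδ)
    refine ⟨max N N', fun k hk l hl => ?_⟩
    obtain ⟨γ, h1, h2, h3, h4, h5⟩ := exists_curve_of_riemDist_lt
      (hN' k (le_of_max_le_right hk) l (le_of_max_le_right hl))
    have h6 : curveLength (gUH c) γ < 1 := by
      refine h5.trans_le ?_
      rw [← ENNReal.ofReal_one]
      exact ENNReal.ofReal_le_ofReal (min_le_left _ _)
    have h7 := hlip γ h1 (hbox' γ h1 h2 h6 (h3 ▸ hmem k (le_of_max_le_left hk))) δ hδ.le h5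
    rw [h3, h4] at h7
    have h8 : dist (u k) (u l) ≤ C * δ := by
      rw [dist_comm, dist_pi_le_iff (by positivity)]
      exact h7
    have h9 : δ ≤ ε / (2 * (C + 1)) := min_le_right _ _
    rw [le_div_iff₀ (by positivity)] at h9
    nlinarith
  obtain ⟨x, hx⟩ := cauchySeq_tendsto_of_complete hcs
  have hx0 : m ≤ x 0 := by
    have h1 : Tendsto (fun k => u k 0) atTop (𝓝 (x 0)) :=
      (continuous_apply 0).continuousAt.tendsto.comp hx
    exact ge_of_tendsto h1 (eventually_atTop.2 ⟨N, fun k hk => (hmem k hk).1⟩)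
  refine ⟨x, hm.trans_le hx0, tendsto_riemDist isOpen_pos (fun i j => ?_) (hm.trans_le hx0) hx⟩
  have h := (isRiemannianOn (σ := 1) (c := c) isOpen_pos
    (fun x hx => mem_regularSet_of_pos hc hx)
    (fun x (hx : 0 < x 0) => by linarith)).smooth i j
  rw [one_smul] at h
  exact h.continuousOn

end complete

end UH
end

noncomputable section

namespace UH

open CoordGeom

/-! ### Incompleteness of the remaining domains -/

variable {c : ℝ}

/-- The missing boundary is `ρ = -c`, that is `r₀ = 0`. Because `|ρ| < c` on this domain, `ρ` itself
is Lipschitz with constant `2 * c`. On the ray `r² < c / 2` keeps `ρ` below `-c / 2`, which yields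
`D = 8 / c`. -/
lemma not_isCompleteOn_of_pos (hc : 0 < c) :
    ¬ IsCompleteOn (gUH c) {x | -c < x 0 ∧ x 0 < 0} := by
  have hreg : {x : Fin 4 → ℝ | -c < x 0 ∧ x 0 < 0} ⊆ regularSet c := fun x hx =>
    ⟨hx.2.ne, by linarith [hx.1], by linarith [hx.1]⟩
  have hU : IsOpen {x : Fin 4 → ℝ | -c < x 0 ∧ x 0 < 0} :=
    (isOpen_lt (by fun_prop) (by fun_prop)).and (isOpen_lt (by fun_prop) (by fun_prop))
  have hs : √(c / 2) ^ 2 = c / 2 := Real.sq_sqrt (by positivity)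
  have hI : ∀ r ∈ Ioo (0 : ℝ) (0 + √(c / 2)), 0 < r ^ 2 ∧ r ^ 2 < c / 2 := by
    intro r hr
    rw [zero_add] at hr
    exact ⟨pow_pos hr.1 2, hs ▸ pow_lt_pow_left₀ hr.2 hr.1.le two_ne_zero⟩
  have h := not_isCompleteOn_gUH (σ := 1) (D := 8 / c) hU hreg
    (fun x hx => by linarith [hx.1]) (f := fun r => r) (f' := fun _ => 1) (K := 2 * c)
    (by fun_prop) (fun x _ => hasDerivAt_id (x 0)) (by positivity) ?_ (le_refl 0)
    (Real.sqrt_pos.2 (half_pos hc)) ?_ ?_ continuousAt_id ?_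
  · rwa [one_smul] at h
  · rintro x ⟨h1, h2⟩
    have hA : 0 < x 0 + c := by linarith
    have hr : 0 < x 0 ^ 2 := sq_pos_of_ne_zero h2.ne
    rw [conf, one_mul, ← mul_div_assoc, le_div_iff₀ (by positivity)]
    have h3 : x 0 ^ 2 ≤ c ^ 2 := by nlinarith
    nlinarith [mul_le_mul_of_nonneg_right h3 hA.le, mul_pos hc hc, sq_nonneg c]
  · intro r hr
    obtain ⟨h1, h2⟩ := hI r hr
    simp only [ray, mem_ofPred_eq, Matrix.cons_val_zero]
    constructor <;> linarith
  · intro r hr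
    obtain ⟨h1, h2⟩ := hI r hr
    rw [div_mul_eq_mul_div, le_div_iff₀ hc]
    nlinarith
  · rintro x ⟨h1, -⟩
    simp only [ne_eq]
    intro h2
    norm_num at h2
    linarith

/-- For `c < 0` the coefficient of `dρ²` vanishes at `ρ = -2c`, so `ρ` is not Lipschitz there.
Squaring puts a factor `ρ + 2c` into the derivative, and dividing by `ρ` gives enough decay for
large `ρ`. -/
lemma hasDerivAt_ratio_sq {r : ℝ} (hr : r ≠ 0) :
    HasDerivAt (fun r => ((r + 2 * c) / r) ^ 2) (-4 * c * (r + 2 * c) / r ^ 3) r := by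
  have h := (((hasDerivAt_id r).add_const (2 * c)).div (hasDerivAt_id r) hr).pow 2
  refine h.congr_deriv ?_
  simp
  field_simp
  ring

/-- This treats both domains with `c < 0`. For the function `((ρ + 2c) / ρ)²` and the constant `K =
8`, the Lipschitz condition is exactly `hle` after cancelling common positive factors. -/
lemma not_isCompleteOn_of_neg {σ D r₀ b : ℝ} {U : Set (Fin 4 → ℝ)} (hc : c < 0)
    (hU : IsOpen U) (hUc : U ⊆ regularSet c) (hpos : ∀ x ∈ U, 0 < σ * (x 0 + 2 * c))
    (hle : ∀ x ∈ U, c ^ 2 * (x 0 + c) * (σ * (x 0 + 2 * c)) ≤ x 0 ^ 4)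
    (hσ : σ * σ = 1) (hr₀ : 0 ≤ r₀)
    (hb0 : 0 < b) (hIU : ∀ r ∈ Ioo r₀ (r₀ + b), ray c r ∈ U)
    (hD : ∀ r ∈ Ioo r₀ (r₀ + b), σ * (r ^ 2 + c) ≤ D * (-c + r ^ 2) ^ 2)
    (hne : ∀ x ∈ U, ((x 0 + 2 * c) / x 0) ^ 2 ≠ ((-c + r₀ ^ 2 + 2 * c) / (-c + r₀ ^ 2)) ^ 2) :
    ¬ IsCompleteOn (σ • gUH c) U := by
  have h0 : -c + r₀ ^ 2 ≠ 0 := by nlinarith [sq_nonneg r₀]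
  refine not_isCompleteOn_gUH (K := 8) hU hUc hpos (f := fun r => ((r + 2 * c) / r) ^ 2)
    (f' := fun r => -4 * c * (r + 2 * c) / r ^ 3) ?_ (fun x hx => hasDerivAt_ratio_sq (hUc hx).1)
    (by norm_num) ?_ hr₀ hb0 hIU hD (hasDerivAt_ratio_sq h0).continuousAt hne
  · intro x hx
    have hx0 := (hUc hx).1
    have h1 : ContDiffAt ℝ 1 (fun y : Fin 4 → ℝ => y 0) x := by fun_prop
    exact (((h1.add contDiffAt_const).div h1 hx0).pow 2).contDiffWithinAt
  · intro x hx
    obtain ⟨h1, h2, h3⟩ := hUc hx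
    have hp := hpos x hx
    have hl := hle x hx
    have hr : 0 < x 0 ^ 2 := sq_pos_of_ne_zero h1
    set B := σ * (x 0 + 2 * c) with hB
    have hB2 : (x 0 + 2 * c) ^ 2 = B ^ 2 := by
      rw [hB, mul_pow, sq σ, hσ, one_mul]
    have e1 : σ * conf c (x 0) = B / (4 * x 0 ^ 2 * (x 0 + c)) := by
      rw [conf, ← mul_div_assoc]
    rw [e1, div_pow, mul_pow, hB2, ← mul_div_assoc, div_le_div_iff₀ (by positivity) (by positivity)]
    have h4 := mul_le_mul_of_nonneg_left hl (mul_nonneg hr.le hp.le)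
    nlinarith

end UH
end

/-! ### The four domains -/

open CoordGeom in
theorem propositionA1 (c : ℝ) :
    (0 < c →
      (IsQuaternionicKahlerOn (gUH c) {x | 0 < x 0} ∧
        (∀ x : Fin 4 → ℝ, 0 < x 0 → scalarCurvature (gUH c) x < 0) ∧
        IsCompleteOn (gUH c) {x | 0 < x 0}) ∧
      (IsQuaternionicKahlerOn (gUH c) {x | -c < x 0 ∧ x 0 < 0} ∧
        (∀ x : Fin 4 → ℝ, -c < x 0 → x 0 < 0 → scalarCurvature (gUH c) x < 0) ∧
        ¬ IsCompleteOn (gUH c) {x | -c < x 0 ∧ x 0 < 0})) ∧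
    (c < 0 →
      (IsQuaternionicKahlerOn (gUH c) {x | -2 * c < x 0} ∧
        (∀ x : Fin 4 → ℝ, -2 * c < x 0 → scalarCurvature (gUH c) x < 0) ∧
        ¬ IsCompleteOn (gUH c) {x | -2 * c < x 0}) ∧
      (IsQuaternionicKahlerOn (-gUH c) {x | -c < x 0 ∧ x 0 < -2 * c} ∧
        (∀ x : Fin 4 → ℝ, -c < x 0 → x 0 < -2 * c → 0 < scalarCurvature (-gUH c) x) ∧
        ¬ IsCompleteOn (-gUH c) {x | -c < x 0 ∧ x 0 < -2 * c})) := by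
  have one : (1 : ℝ) • gUH c = gUH c := one_smul _ _
  have neg : (-1 : ℝ) • gUH c = -gUH c := by rw [neg_smul, one_smul]
  have hscal : ∀ x ∈ UH.regularSet c, scalarCurvature (gUH c) x < 0 := by
    intro x hx
    rw [← one, UH.scalarCurvature_gUH one_ne_zero hx]
    norm_num
  have hopen : ∀ a b : ℝ, IsOpen {x : Fin 4 → ℝ | a < x 0 ∧ x 0 < b} := fun a b =>
    (isOpen_lt (by fun_prop) (by fun_prop)).and (isOpen_lt (by fun_prop) (by fun_prop))
  refine ⟨fun hc => ⟨⟨?_, fun x hx => hscal x (UH.mem_regularSet_of_pos hc hx),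
    UH.isCompleteOn_gUH hc⟩, ?_, fun x h1 h2 => hscal x ⟨h2.ne, by linarith, by linarith⟩,
    UH.not_isCompleteOn_of_pos hc⟩, fun hc => ⟨⟨?_, fun x hx => ?_, ?_⟩, ?_, fun x h1 h2 => ?_, ?_⟩⟩
  · rw [← one]
    exact UH.isQuaternionicKahlerOn UH.isOpen_pos (fun x hx => UH.mem_regularSet_of_pos hc hx)
      one_ne_zero (fun x (hx : 0 < x 0) => by linarith)
  · rw [← one]
    exact UH.isQuaternionicKahlerOn (hopen _ _)
      (fun x hx => ⟨hx.2.ne, by linarith [hx.1], by linarith [hx.1]⟩) one_ne_zero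
      (fun x hx => by linarith [hx.1])
  · rw [← one]
    exact UH.isQuaternionicKahlerOn (isOpen_lt (by fun_prop) (by fun_prop))
      (fun x (hx : -2 * c < x 0) => ⟨by linarith, by linarith, by linarith⟩) one_ne_zero
      (fun x (hx : -2 * c < x 0) => by linarith)
  · exact hscal x ⟨by linarith, by linarith, by linarith⟩
  · rw [← one]
    have hs : √(-c) ^ 2 = -c := Real.sq_sqrt (by linarith)
    have hI : ∀ r ∈ Ioo (√(-c)) (√(-c) + 1), -c < r ^ 2 := fun r hr =>
      hs ▸ pow_lt_pow_left₀ hr.1 (Real.sqrt_nonneg _) two_ne_zero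
    -- The boundary approached is `ρ = -2c`, that is `r² = -c`, where the test function tends to 0
    -- while it is positive inside. Any `b > 0` would do.
    refine UH.not_isCompleteOn_of_neg (D := 1 / (-2 * c)) (r₀ := √(-c)) (b := 1) hc
      (isOpen_lt (by fun_prop) (by fun_prop))
      (fun x (hx : -2 * c < x 0) => ⟨by linarith, by linarith, by linarith⟩)
      (fun x (hx : -2 * c < x 0) => by linarith) (fun x (hx : -2 * c < x 0) => ?_) (one_mul 1)
      (Real.sqrt_nonneg _) one_pos (fun r hr => ?_) (fun r hr => ?_)
      (fun x (hx : -2 * c < x 0) => ?_)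
    · have h1 : c ^ 2 ≤ x 0 ^ 2 := by nlinarith
      have h2 : (x 0 + c) * (x 0 + 2 * c) ≤ x 0 ^ 2 := by nlinarith
      have h3 : 0 ≤ (x 0 + c) * (x 0 + 2 * c) := mul_nonneg (by linarith) (by linarith)
      calc c ^ 2 * (x 0 + c) * (1 * (x 0 + 2 * c)) = c ^ 2 * ((x 0 + c) * (x 0 + 2 * c)) := by ring
        _ ≤ x 0 ^ 2 * x 0 ^ 2 := mul_le_mul h1 h2 h3 (sq_nonneg _)
        _ = x 0 ^ 4 := by ring
    · have := hI r hr
      simp only [UH.ray, mem_ofPred_eq, Matrix.cons_val_zero]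
      linarith
    · have := hI r hr
      rw [div_mul_eq_mul_div, le_div_iff₀ (by linarith)]
      nlinarith
    · rw [hs]
      have h1 : 0 < ((x 0 + 2 * c) / x 0) ^ 2 :=
        pow_pos (div_pos (by linarith) (by linarith)) 2
      have h2 : -c + -c + 2 * c = 0 := by ring
      rw [h2, zero_div, zero_pow two_ne_zero]
      exact h1.ne'
  · rw [← neg]
    exact UH.isQuaternionicKahlerOn (hopen _ _)
      (fun x hx => ⟨by linarith [hx.1], by linarith [hx.1], by linarith [hx.2]⟩) (by norm_num)
      (fun x hx => by linarith [hx.2])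
  · rw [← neg, UH.scalarCurvature_gUH (by norm_num) ⟨by linarith, by linarith, by linarith⟩]
    norm_num
  · rw [← neg]
    have hs : √(-c) ^ 2 = -c := Real.sq_sqrt (by linarith)
    have hI : ∀ r ∈ Ioo 0 (0 + √(-c)), 0 < r ^ 2 ∧ r ^ 2 < -c := fun r hr => by
      rw [zero_add] at hr
      exact ⟨pow_pos hr.1 2, hs ▸ pow_lt_pow_left₀ hr.2 hr.1.le two_ne_zero⟩
    -- The boundary approached is `ρ = -c`, where the test function tends to 1; inside it is smaller
    -- than 1 because `-2c - ρ < ρ`. The range `r < √(-c)` keeps `ρ` below `-2c`.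
    refine UH.not_isCompleteOn_of_neg (D := 1 / (-c)) (r₀ := 0) (b := √(-c)) hc (hopen _ _)
      (fun x hx => ⟨by linarith [hx.1], by linarith [hx.1], by linarith [hx.2]⟩)
      (fun x hx => by linarith [hx.2]) (fun x hx => ?_) (by norm_num) le_rfl
      (Real.sqrt_pos.2 (by linarith)) (fun r hr => ?_) (fun r hr => ?_) (fun x hx => ?_)
    · obtain ⟨h1, h2⟩ := hx
      have h3 : c ^ 2 ≤ x 0 ^ 2 := by nlinarith
      have h4 : (x 0 + c) * (-1 * (x 0 + 2 * c)) ≤ x 0 ^ 2 := by nlinarith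
      have h5 : 0 ≤ (x 0 + c) * (-1 * (x 0 + 2 * c)) := mul_nonneg (by linarith) (by linarith)
      calc c ^ 2 * (x 0 + c) * (-1 * (x 0 + 2 * c)) =
            c ^ 2 * ((x 0 + c) * (-1 * (x 0 + 2 * c))) := by ring
        _ ≤ x 0 ^ 2 * x 0 ^ 2 := mul_le_mul h3 h4 h5 (sq_nonneg _)
        _ = x 0 ^ 4 := by ring
    · obtain ⟨h1, h2⟩ := hI r hr
      simp only [UH.ray, mem_ofPred_eq, Matrix.cons_val_zero]
      constructor <;> linarith
    · obtain ⟨h1, h2⟩ := hI r hr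
      rw [div_mul_eq_mul_div, le_div_iff₀ (by linarith)]
      nlinarith
    · obtain ⟨h1, h2⟩ := hx
      have hx0 : 0 < x 0 := by linarith
      have e1 : ((-c + 0 ^ 2 + 2 * c) / (-c + 0 ^ 2)) ^ 2 = (1 : ℝ) := by
        have h3 : -c + 0 ^ 2 + 2 * c = c := by ring
        have h4 : -c + 0 ^ 2 = -c := by ring
        rw [h3, h4, div_neg, neg_sq, div_self hc.ne, one_pow]
      rw [e1]
      refine ne_of_lt ?_
      rw [div_pow, div_lt_one (by positivity)]
      nlinarith
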